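/- **Setting.** Let $\kappa$ be the computational and $\lambda=\lambda(\kappa)$ the statistical security parameter, polynomially bounded in each other. All other parameters depend on $\kappa$. Let $\mathbb F$ (e.g. the additive group of a finite field) and $\mathbb K$ be finite abelian groups with injective binary encodings, and $F:\mathbb K\times\mathbb F\to\mathbb F$ a pseudorandom function, secure against polynomial-size oracle circuits. The sender $\mathcal S$ holds $Q=(q_1,\dots,q_m)$ and the receiver $\mathcal R$ holds $W=(w_1,\dots,w_n)$, whose elements are in $\mathbb U^d$, $\mathbb U=\{0,\dots,2^u-1\}$. The quantities $m,n,d$, the threshold $\delta\in\mathbb N$, and the bit lengths of elements of $\mathbb F$ and of key strings are polynomially bounded in $\kappa$, and $|\mathbb F|\ge n^2 2^{\lambda}$. Key strings are an unambiguous encoding in $\{0,1\}^a$ of the pairs $k\|x$ (with $k\in[d]$ and $x\in[-\delta,2^u-1+\delta]$) and of reserved dummy keys. A tuple $W$ satisfies the *$\delta$-disjoint projection assumption* if for each $i$ there is $k\in[d]$ with $[w_{i,k}-\delta,w_{i,k}+\delta]\cap[w_{j,k}-\delta,w_{j,k}+\delta]=\emptyset$ for all $j\ne i$. **Functionalities.**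 *so-OPPRF:* the OPPRF sender inputs a key-value list $L$, the OPPRF receiver inputs queries $x_1,x_2,\dots$. A function $F':\{0,1\}^a\to\mathbb F$ is drawn uniformly among those that agree with $L$. Each $y_i=F'(x_i)$ is split as $y_i=y_i^{\mathrm{snd}}+y_i^{\mathrm{rcv}}$ uniformly at random. The OPPRF sender gets all $y_i^{\mathrm{snd}}$ and oracle access to $F'$; the OPPRF receiver gets all $y_i^{\mathrm{rcv}}$. *si-OPRF:* on key shares $k^{\mathcal S},k^{\mathcal R}$ and input shares $x_i^{\mathrm{snd}},x_i^{\mathrm{rcv}}$, its receiver gets $F_{k^{\mathcal S}+k^{\mathcal R}}(x_i^{\mathrm{snd}}+x_i^{\mathrm{rcv}})$ for all $i$ and its sender gets nothing. **LocalMap$(Q)$.** In each dimension $k$, for $j=1,\dots,m$, sample $r_{j,k}\leftarrow\mathbb F$, start with $U=[q_{j,k}-\delta,q_{j,k}+\delta]$, remove from $\mathsf{interval}_k$ every $(U',r')$ whose set meets $U$ while replacing $U$ by $U\cup U'$, and add $(U,r_{j,k})$. Then $\mathsf{pid}_{q_j}$ is the sum over $k$ of the value whose set in $\mathsf{interval}_k$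 contains $q_{j,k}$. $\mathsf{List}$ consists of $(k\|x,r)$ for all $k$, $(U,r)\in\mathsf{interval}_k$, $x\in U$, padded to size $md(2\delta+1)$ with dummy keys carrying random values. **Protocol $\Pi_{\mathsf{FMap}}$.** (1) $\mathcal S$ and $\mathcal R$ run LocalMap on $Q$ and on $W$, getting $\mathsf{pid}_{q_j},\mathsf{List}^{\mathcal S}$ and $\mathsf{pid}_{w_i},\mathsf{List}^{\mathcal R}$, and sample key shares $k^{\mathcal S},k^{\mathcal R}\leftarrow\mathbb K$. (2) They call so-OPPRF with sender $\mathcal S$ on $\mathsf{List}^{\mathcal S}$ and receiver $\mathcal R$ on the queries $k\|w_{i,k}$, and each sums its shares over $k$, giving $r^{\mathcal S}_{w_i}$ and $r^{\mathcal R}_{w_i}$. (3) By si-OPRF on input shares $r^{\mathcal S}_{w_i}$ and $r^{\mathcal R}_{w_i}+\mathsf{pid}_{w_i}$, $\mathcal R$ learns $\mathsf{ID}_{w_i}$. (4) Steps 2 and 3 are repeated with the roles exchanged and the same key shares, and $\mathcal S$ learns $\mathsf{ID}_{q_j}$. The view of a party consists of its input, its coins, and everything it receives from the functionalities, including access to its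 oracle. **Theorem.** For all inputs of both parties that satisfy the $\delta$-disjoint projection assumption: 1. *Correctness.* In every execution, $\|q_j-w_i\|_\infty\le\delta$ implies $\mathsf{ID}_{q_j}=\mathsf{ID}_{w_i}$. 2. *Distinctiveness.* For all $i\ne i'$, $\Pr[\mathsf{ID}_{w_i}=\mathsf{ID}_{w_{i'}}]\le\mathsf{negl}(\lambda)$, with one negligible function for all inputs. 3. *Security.* $\mathsf{view}_{\mathcal S}(Q,W)\approx_c\mathsf{view}_{\mathcal S}(Q,W')$ for all $Q,W,W'$, and $\mathsf{view}_{\mathcal R}(Q,W)\approx_c\mathsf{view}_{\mathcal R}(Q',W)$ for all $Q,Q',W$. That is, every family of polynomial-size circuits, which read the bits of the view and query its oracle, has advantage bounded by a function negligible in $\kappa$, uniformly in the inputs. -/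

import Mathlib

namespace FuzzyMapping

/-! ### Probability over finite coin spaces, polynomial bounds, negligible functions -/

/-- `Pr[E]` when `ω` is drawn uniformly from the finite set `Ω`. -/
noncomputable def prob {Ω : Type*} [Finite Ω] (E : Ω → Prop) : ℝ :=
  (Nat.card {ω : Ω // E ω} : ℝ) / (Nat.card Ω : ℝ)

/-- `f` is bounded by a polynomial in the security parameter. -/
def PolyBounded (f : ℕ → ℕ) : Prop :=
  ∃ p : Polynomial ℕ, ∀ κ, f κ ≤ p.eval κ

/-- `lam κ` and `κ` are bounded by polynomials in each other. -/
def PolyRelated (lam : ℕ → ℕ) : Prop :=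
  PolyBounded lam ∧ ∃ p : Polynomial ℕ, ∀ κ, κ ≤ p.eval (lam κ)

/-- `f` vanishes faster than the inverse of any polynomial. -/
def Negligible (f : ℕ → ℝ) : Prop :=
  Asymptotics.SuperpolynomialDecay Filter.atTop (fun κ : ℕ => (κ : ℝ)) f

/-! ### Adversaries: Boolean oracle circuits, written as straight-line programs -/

/-- Bit strings of length `a`. -/
abbrev BitStr (a : ℕ) : Type := Fin a → Bool

/-- One gate of a Boolean oracle circuit with input bits indexed by `ι` and with an oracle
`{0,1}^a → {0,1}^b`. Wires are registers numbered by `ℕ`; every gate writes its result to `dst`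
(an oracle gate writes its `b` output bits to `dst, …, dst + b - 1`). -/
inductive Gate (ι : Type) (a b : ℕ) : Type
  | const (dst : ℕ) (v : Bool)
  | load (dst : ℕ) (i : ι)
  | nand (dst x y : ℕ)
  | query (dst : ℕ) (src : Fin a → ℕ)

/-- The cost of a gate: `1`, or the number of wires it touches for an oracle gate. -/
def Gate.cost {ι : Type} {a b : ℕ} : Gate ι a b → ℕ
  | .const _ _ => 1
  | .load _ _ => 1
  | .nand _ _ _ => 1
  | .query _ _ => 1 + a + b

/-- Effect of one gate on the registers. -/
def Gate.exec {ι : Type} {a b : ℕ} (oracle : BitStr a → BitStr b) (input : ι → Bool)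
    (reg : ℕ → Bool) : Gate ι a b → (ℕ → Bool)
  | .const dst v => Function.update reg dst v
  | .load dst i => Function.update reg dst (input i)
  | .nand dst x y => Function.update reg dst (!(reg x && reg y))
  | .query dst src => fun s =>
      if h : dst ≤ s ∧ s - dst < b then oracle (fun t => reg (src t)) ⟨s - dst, h.2⟩ else reg s

/-- A Boolean oracle circuit: a sequence of gates. -/
abbrev Circuit (ι : Type) (a b : ℕ) : Type := List (Gate ι a b)

/-- The size of a circuit. -/
def Circuit.size {ι : Type} {a b : ℕ} (C : Circuit ι a b) : ℕ := (C.map Gate.cost).sum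

/-- The circuit accepts if register `0` finally holds `true`; registers start as `false`. -/
def Circuit.accepts {ι : Type} {a b : ℕ} (C : Circuit ι a b) (oracle : BitStr a → BitStr b)
    (input : ι → Bool) : Prop :=
  C.foldl (fun reg g => g.exec oracle input reg) (fun _ => false) 0 = true

/-! ### Pseudorandom functions -/

/-- The function `f` on bit strings, through the binary encoding `enc`
(strings that encode nothing are answered by `0…0`). -/
noncomputable def bitOracle {FF : Type*} {ℓ : ℕ} (enc : FF → BitStr ℓ) (f : FF → FF) :
    BitStr ℓ → BitStr ℓ :=
  Function.extend enc (fun x => enc (f x)) (fun _ _ => false)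

/-- `F` is a pseudorandom function against non-uniform polynomial-time adversaries: no family of
polynomial-size oracle circuits distinguishes `F_k`, for a uniform key `k`, from a uniformly random
function with more than negligible advantage. -/
def IsPRF {FF KK : ℕ → Type} [∀ κ, Finite (FF κ)] [∀ κ, Finite (KK κ)] {ℓ : ℕ → ℕ}
    (enc : ∀ κ, FF κ → BitStr (ℓ κ)) (F : ∀ κ, KK κ → FF κ → FF κ) : Prop :=
  ∀ A : ∀ κ, Circuit Empty (ℓ κ) (ℓ κ), PolyBounded (fun κ => (A κ).size) →
    Negligible fun κ =>
      |prob (fun k : KK κ => (A κ).accepts (bitOracle (enc κ) (F κ k)) Empty.elim) -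
        prob (fun f : FF κ → FF κ => (A κ).accepts (bitOracle (enc κ) f) Empty.elim)|

/-! ### The ideal functionalities -/

/-- The random function that agrees with the key-value list `L` and takes the values of the
uniformly random function `g` on all other keys. -/
def programmed {a : ℕ} {FF : Type*} (L : List (BitStr a × FF)) (g : BitStr a → FF) :
    BitStr a → FF :=
  fun x => (L.lookup x).getD (g x)

/-- Randomness of the shared-output OPPRF functionality for queries indexed by `I`: a random
function and the sender's random output shares. -/
structure OpprfCoins (a : ℕ) (FF : Type*) (I : Type) where
  fn : BitStr a → FF
  share : I → FF

/-- Output of the shared-output OPPRF functionality: the sender's shares and its oracle to the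
programmed function, and the receiver's shares. -/
structure OpprfOut (a : ℕ) (FF : Type*) (I : Type) where
  senderShare : I → FF
  senderOracle : BitStr a → FF
  receiverShare : I → FF

/-- The shared-output OPPRF functionality on the sender's list `L` and the receiver's queries `X`:
the values of the programmed random function at the queries are additively shared. -/
def soOPPRF {a : ℕ} {FF : Type*} [AddCommGroup FF] {I : Type} (L : List (BitStr a × FF))
    (X : I → BitStr a) (c : OpprfCoins a FF I) : OpprfOut a FF I where
  senderShare := c.share
  senderOracle := programmed L c.fn
  receiverShare := fun i => programmed L c.fn (X i) - c.share i

/-- The shared-input OPRF functionality for `F`: key and inputs are additively shared, the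
receiver gets the outputs and the sender gets nothing. -/
def siOPRF {FF KK : Type*} [AddCommGroup FF] [AddCommGroup KK] {I : Type} (F : KK → FF → FF)
    (kSender kReceiver : KK) (xSender xReceiver : I → FF) : I → FF :=
  fun i => F (kSender + kReceiver) (xSender i + xReceiver i)

/-! ### Local mapping (without prefix optimization) -/

/-- A list of pairs of a set of integers and the value assigned to it. -/
abbrev IntervalList (FF : Type*) : Type _ := List (Finset ℤ × FF)

/-- Insert `[x - δ, x + δ]` with value `r`: each stored set that meets the current set is removed
and merged into it. -/
noncomputable def insertInterval {FF : Type*} (δ : ℕ) (x : ℤ) (r : FF) (L : IntervalList FF) :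
    IntervalList FF :=
  let res := L.foldl
    (fun (acc : Finset ℤ × IntervalList FF) e =>
      if (acc.1 ∩ e.1).Nonempty then (acc.1 ∪ e.1, acc.2) else (acc.1, acc.2 ++ [e]))
    (Finset.Icc (x - δ) (x + δ), [])
  res.2 ++ [(res.1, r)]

/-- The final interval list of one dimension, whose coordinates are `x 0, …, x (m - 1)` with
sampled values `r 0, …, r (m - 1)`. -/
noncomputable def intervals {FF : Type*} {m : ℕ} (δ : ℕ) (x : Fin m → ℤ) (r : Fin m → FF) : IntervalList FF :=
  (List.finRange m).foldl (fun L j => insertInterval δ (x j) (r j) L) []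

/-- The value assigned to the set that contains `x`. -/
noncomputable def valueAt {FF : Type*} [Zero FF] (L : IntervalList FF) (x : ℤ) : FF :=
  match L.find? (fun e => decide (x ∈ e.1)) with
  | some e => e.2
  | none => 0

/-- The local identifier of the `j`-th element, for sampled values `r`. -/
noncomputable def pid {FF : Type*} [AddCommGroup FF] {m d : ℕ} (δ : ℕ) (q : Fin m → Fin d → ℤ)
    (r : Fin m → Fin d → FF) (j : Fin m) : FF :=
  ∑ k, valueAt (intervals δ (fun i => q i k) (fun i => r i k)) (q j k)

/-- The unpadded key-value list: key `(k, x)` for every point `x` of every set of dimension `k`. -/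
noncomputable def rawList {FF : Type*} {m d : ℕ} (δ : ℕ) (q : Fin m → Fin d → ℤ)
    (r : Fin m → Fin d → FF) : List ((Fin d × ℤ) × FF) :=
  (List.finRange d).flatMap fun k =>
    (intervals δ (fun i => q i k) (fun i => r i k)).flatMap fun e =>
      e.1.toList.map fun x => ((k, x), e.2)

/-- The key-value list with encoded keys, padded with dummy items (reserved keys `Sum.inr t`,
random values) to size `m * d * (2 * δ + 1)`. -/
noncomputable def paddedList {FF : Type*} {m d a : ℕ} (δ : ℕ)
    (keyEnc : (Fin d × ℤ) ⊕ ℕ → BitStr a) (q : Fin m → Fin d → ℤ) (r : Fin m → Fin d → FF)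
    (dummy : Fin (m * d * (2 * δ + 1)) → FF) : List (BitStr a × FF) :=
  (rawList δ q r).map (fun e => (keyEnc (Sum.inl e.1), e.2)) ++
    ((List.finRange (m * d * (2 * δ + 1))).take
      (m * d * (2 * δ + 1) - (rawList δ q r).length)).map
        fun t : Fin (m * d * (2 * δ + 1)) => (keyEnc (Sum.inr t.val), dummy t)

/-! ### The protocol -/

/-- Public parameters: set sizes `m` (sender) and `n` (receiver), dimension `d`, threshold `δ`,
coordinates in `{0, …, 2^u - 1}`, an unambiguous binary encoding of length `a` of the keys `k ‖ x`
and of the dummy keys, binary encodings of `FF` and `KK`, and the keyed function `F`. -/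
structure Params (FF KK : Type) where
  m : ℕ
  n : ℕ
  d : ℕ
  δ : ℕ
  u : ℕ
  a : ℕ
  keyEnc : (Fin d × ℤ) ⊕ ℕ → BitStr a
  keyEnc_injOn : Set.InjOn keyEnc
    (Sum.inl '' {p : Fin d × ℤ | -(δ : ℤ) ≤ p.2 ∧ p.2 < 2 ^ u + δ} ∪
      Sum.inr '' {t : ℕ | t < max m n * d * (2 * δ + 1)})
  ℓ : ℕ
  encF : FF → BitStr ℓ
  encF_injective : Function.Injective encF
  c : ℕ
  encK : KK → BitStr c
  encK_injective : Function.Injective encK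
  F : KK → FF → FF

/-- A party's input: a tuple of `m` vectors with coordinates in `{0, …, 2^u - 1}`. -/
abbrev Input (m d u : ℕ) : Type := Fin m → Fin d → Fin (2 ^ u)

/-- The input as a tuple of integer vectors. -/
def Input.toInt {m d u : ℕ} (Q : Input m d u) : Fin m → Fin d → ℤ := fun j k => ((Q j k : ℕ) : ℤ)

/-- The `δ`-disjoint projection assumption. -/
def DisjointProjection {m d u : ℕ} (δ : ℕ) (W : Input m d u) : Prop :=
  ∀ i, ∃ k, ∀ j, j ≠ i →
    Set.Icc (W.toInt i k - δ) (W.toInt i k + δ) ∩ Set.Icc (W.toInt j k - δ) (W.toInt j k + δ) = ∅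

/-- Coins of a party holding `m` elements: the values sampled by the local mapping, the values of
the dummy items, and its share of the PRF key. -/
structure PartyCoins (FF KK : Type) (m d δ : ℕ) where
  r : Fin m → Fin d → FF
  dummy : Fin (m * d * (2 * δ + 1)) → FF
  key : KK

/-- All coins of an execution: those of the two parties, and those of the two invocations of the
shared-output OPPRF functionality. -/
structure Coins {FF KK : Type} (P : Params FF KK) where
  sender : PartyCoins FF KK P.m P.d P.δ
  receiver : PartyCoins FF KK P.n P.d P.δ
  opprf₁ : OpprfCoins P.a FF (Fin P.n × Fin P.d)
  opprf₂ : OpprfCoins P.a FF (Fin P.m × Fin P.d)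

instance {a : ℕ} {FF : Type*} {I : Type} [Finite FF] [Finite I] : Finite (OpprfCoins a FF I) :=
  Finite.of_injective (fun c => (c.fn, c.share)) (by
    rintro ⟨_, _⟩ ⟨_, _⟩ h; simpa using h)

instance {FF KK : Type} {m d δ : ℕ} [Finite FF] [Finite KK] : Finite (PartyCoins FF KK m d δ) :=
  Finite.of_injective (fun c => (c.r, c.dummy, c.key)) (by
    rintro ⟨_, _, _⟩ ⟨_, _, _⟩ h; simpa using h)

instance {FF KK : Type} (P : Params FF KK) [Finite FF] [Finite KK] : Finite (Coins P) :=
  Finite.of_injective (fun c => (c.sender, c.receiver, c.opprf₁, c.opprf₂)) (by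
    rintro ⟨_, _, _, _⟩ ⟨_, _, _, _⟩ h; simpa using h)

/-- View of a party that holds `m` elements while the other party holds `n`: its input, its coins,
and everything it receives from the functionalities. -/
structure View (FF KK : Type) (m n d δ u a : ℕ) where
  input : Input m d u
  coins : PartyCoins FF KK m d δ
  /-- output shares of the OPPRF invocation in which the party is the OPPRF sender -/
  asSender : Fin n × Fin d → FF
  /-- the oracle received in that invocation -/
  oracle : BitStr a → FF
  /-- output shares of the OPPRF invocation in which the party is the OPPRF receiver -/
  asReceiver : Fin m × Fin d → FF
  /-- the identifiers, received from the shared-input OPRF -/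
  ids : Fin m → FF

section Protocol

variable {FF KK : Type} [AddCommGroup FF] [AddCommGroup KK] (P : Params FF KK)
  (Q : Input P.m P.d P.u) (W : Input P.n P.d P.u) (ω : Coins P)

/-- First OPPRF invocation: the sender programs its list, the receiver queries `k ‖ w_{i,k}`. -/
noncomputable def Params.out₁ : OpprfOut P.a FF (Fin P.n × Fin P.d) :=
  soOPPRF (paddedList P.δ P.keyEnc Q.toInt ω.sender.r ω.sender.dummy)
    (fun p => P.keyEnc (Sum.inl (p.2, W.toInt p.1 p.2))) ω.opprf₁

/-- Second OPPRF invocation: the receiver programs its list, the sender queries `k ‖ q_{j,k}`. -/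
noncomputable def Params.out₂ : OpprfOut P.a FF (Fin P.m × Fin P.d) :=
  soOPPRF (paddedList P.δ P.keyEnc W.toInt ω.receiver.r ω.receiver.dummy)
    (fun p => P.keyEnc (Sum.inl (p.2, Q.toInt p.1 p.2))) ω.opprf₂

/-- The receiver's identifiers `ID_{w_i}`. -/
noncomputable def Params.idW : Fin P.n → FF :=
  siOPRF P.F ω.sender.key ω.receiver.key
    (fun i => ∑ k, (P.out₁ Q W ω).senderShare (i, k))
    (fun i => (∑ k, (P.out₁ Q W ω).receiverShare (i, k)) + pid P.δ W.toInt ω.receiver.r i)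

/-- The sender's identifiers `ID_{q_j}`. -/
noncomputable def Params.idQ : Fin P.m → FF :=
  siOPRF P.F ω.receiver.key ω.sender.key
    (fun j => ∑ k, (P.out₂ Q W ω).senderShare (j, k))
    (fun j => (∑ k, (P.out₂ Q W ω).receiverShare (j, k)) + pid P.δ Q.toInt ω.sender.r j)

/-- The sender's view. -/
noncomputable def Params.viewS : View FF KK P.m P.n P.d P.δ P.u P.a where
  input := Q
  coins := ω.sender
  asSender := (P.out₁ Q W ω).senderShare
  oracle := (P.out₁ Q W ω).senderOracle
  asReceiver := (P.out₂ Q W ω).receiverShare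
  ids := P.idQ Q W ω

/-- The receiver's view. -/
noncomputable def Params.viewR : View FF KK P.n P.m P.d P.δ P.u P.a where
  input := W
  coins := ω.receiver
  asSender := (P.out₂ Q W ω).senderShare
  oracle := (P.out₂ Q W ω).senderOracle
  asReceiver := (P.out₁ Q W ω).receiverShare
  ids := P.idW Q W ω

end Protocol

/-! ### Computational indistinguishability of views -/

/-- Positions of the bits of a view (its oracle apart), when field elements take `ℓ` bits and key
shares take `c` bits. -/
inductive ViewBit (m n d δ u ℓ c : ℕ) : Type
  | input (j : Fin m) (k : Fin d) (t : Fin u)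
  | value (j : Fin m) (k : Fin d) (t : Fin ℓ)
  | dummy (i : Fin (m * d * (2 * δ + 1))) (t : Fin ℓ)
  | key (t : Fin c)
  | asSender (i : Fin n) (k : Fin d) (t : Fin ℓ)
  | asReceiver (j : Fin m) (k : Fin d) (t : Fin ℓ)
  | id (j : Fin m) (t : Fin ℓ)

/-- The bits of a view. -/
def View.bits {FF KK : Type} {m n d δ u a ℓ c : ℕ} (encF : FF → BitStr ℓ) (encK : KK → BitStr c)
    (v : View FF KK m n d δ u a) : ViewBit m n d δ u ℓ c → Bool
  | .input j k t => (v.input j k : ℕ).testBit t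
  | .value j k t => encF (v.coins.r j k) t
  | .dummy i t => encF (v.coins.dummy i) t
  | .key t => encK v.coins.key t
  | .asSender i k t => encF (v.asSender (i, k)) t
  | .asReceiver j k t => encF (v.asReceiver (j, k)) t
  | .id j t => encF (v.ids j) t

/-- The circuit `D` accepts the view: it reads the bits of the view and queries its oracle. -/
def View.acceptedBy {FF KK : Type} {m n d δ u a ℓ c : ℕ} (encF : FF → BitStr ℓ)
    (encK : KK → BitStr c) (v : View FF KK m n d δ u a)
    (D : Circuit (ViewBit m n d δ u ℓ c) a ℓ) : Prop :=
  D.accepts (fun s => encF (v.oracle s)) (v.bits encF encK)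

/-! ### The defining properties of fuzzy mapping -/

section Properties

variable {FF KK : ℕ → Type} [∀ κ, AddCommGroup (FF κ)] [∀ κ, AddCommGroup (KK κ)]
  (P : ∀ κ, Params (FF κ) (KK κ))

/-- Both inputs satisfy the disjoint projection assumption. -/
def Admissible {FF KK : Type} (P : Params FF KK) (Q : Input P.m P.d P.u) (W : Input P.n P.d P.u) :
    Prop :=
  DisjointProjection P.δ Q ∧ DisjointProjection P.δ W

/-- In every execution, `δ`-close elements get equal identifiers. The distance on `Fin d → ℤ` is
the maximum of the coordinate distances. -/
def Correctness : Prop :=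
  ∀ κ Q W, Admissible (P κ) Q W → ∀ ω j i,
    dist (W.toInt i) (Q.toInt j) ≤ (P κ).δ → (P κ).idQ Q W ω j = (P κ).idW Q W ω i

variable [∀ κ, Finite (FF κ)] [∀ κ, Finite (KK κ)]

/-- Identifiers of different elements of the receiver collide with probability negligible in the
statistical security parameter `lam κ`. -/
def Distinctiveness (lam : ℕ → ℕ) : Prop :=
  ∃ ν : ℕ → ℝ, Negligible ν ∧ ∀ κ Q W, Admissible (P κ) Q W → ∀ i i' : Fin (P κ).n, i ≠ i' →
    prob (fun ω : Coins (P κ) => (P κ).idW Q W ω i = (P κ).idW Q W ω i') ≤ ν (lam κ)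

/-- Security against a corrupted sender: its views for any two inputs of the receiver are
computationally indistinguishable. -/
def SenderSecurity : Prop :=
  ∀ D : ∀ κ, Circuit (ViewBit (P κ).m (P κ).n (P κ).d (P κ).δ (P κ).u (P κ).ℓ (P κ).c)
      (P κ).a (P κ).ℓ,
    PolyBounded (fun κ => (D κ).size) →
    ∃ ν : ℕ → ℝ, Negligible ν ∧ ∀ κ Q W W', Admissible (P κ) Q W → Admissible (P κ) Q W' →
      |prob (fun ω : Coins (P κ) =>
          ((P κ).viewS Q W ω).acceptedBy (P κ).encF (P κ).encK (D κ)) -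
        prob (fun ω : Coins (P κ) =>
          ((P κ).viewS Q W' ω).acceptedBy (P κ).encF (P κ).encK (D κ))| ≤ ν κ

/-- Security against a corrupted receiver: its views for any two inputs of the sender are
computationally indistinguishable. -/
def ReceiverSecurity : Prop :=
  ∀ D : ∀ κ, Circuit (ViewBit (P κ).n (P κ).m (P κ).d (P κ).δ (P κ).u (P κ).ℓ (P κ).c)
      (P κ).a (P κ).ℓ,
    PolyBounded (fun κ => (D κ).size) →
    ∃ ν : ℕ → ℝ, Negligible ν ∧ ∀ κ Q Q' W, Admissible (P κ) Q W → Admissible (P κ) Q' W →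
      |prob (fun ω : Coins (P κ) =>
          ((P κ).viewR Q W ω).acceptedBy (P κ).encF (P κ).encK (D κ)) -
        prob (fun ω : Coins (P κ) =>
          ((P κ).viewR Q' W ω).acceptedBy (P κ).encF (P κ).encK (D κ))| ≤ ν κ

end Properties

end FuzzyMapping

namespace FuzzyMapping

/-! ### Averages over finite types -/

/-- The expectation of `f ω` for uniform `ω`. -/
noncomputable def avg {Ω : Type*} [Finite Ω] (f : Ω → ℝ) : ℝ :=
  (∑ᶠ ω, f ω) / (Nat.card Ω : ℝ)

open Classical in
/-- The indicator of a proposition. -/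
noncomputable def ind (p : Prop) : ℝ := if p then 1 else 0

lemma ind_nonneg (p : Prop) : 0 ≤ ind p := by
  unfold ind; split_ifs <;> norm_num

lemma ind_le_one (p : Prop) : ind p ≤ 1 := by
  unfold ind; split_ifs <;> norm_num

lemma ind_mono {p q : Prop} (h : p → q) : ind p ≤ ind q := by
  unfold ind; split_ifs <;> first | tauto | norm_num

section Avg

variable {Ω Ω' : Type*} [Finite Ω] [Finite Ω']

lemma avg_eq_sum {Ω : Type*} [Fintype Ω] (f : Ω → ℝ) :
    avg f = (∑ ω, f ω) / (Fintype.card Ω : ℝ) := by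
  rw [avg, finsum_eq_sum_of_fintype, Nat.card_eq_fintype_card]

lemma prob_eq_avg (E : Ω → Prop) : prob E = avg fun ω => ind (E ω) := by
  classical
  have := Fintype.ofFinite Ω
  rw [avg_eq_sum, prob, Nat.card_eq_fintype_card, Nat.card_eq_fintype_card, Fintype.card_subtype]
  simp [ind]

lemma avg_congr_equiv (e : Ω ≃ Ω') (f : Ω' → ℝ) : avg (fun ω => f (e ω)) = avg f := by
  rw [avg, avg, Nat.card_congr e, finsum_comp_equiv e]

lemma avg_const [Nonempty Ω] (c : ℝ) : avg (fun _ : Ω => c) = c := by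
  have := Fintype.ofFinite Ω
  rw [avg_eq_sum]
  have : (Fintype.card Ω : ℝ) ≠ 0 := by exact_mod_cast Fintype.card_ne_zero
  simp [mul_div_cancel_left₀ _ this]

lemma avg_add (f g : Ω → ℝ) : avg (fun ω => f ω + g ω) = avg f + avg g := by
  have := Fintype.ofFinite Ω
  simp only [avg_eq_sum, Finset.sum_add_distrib, add_div]

lemma avg_sub (f g : Ω → ℝ) : avg (fun ω => f ω - g ω) = avg f - avg g := by
  have := Fintype.ofFinite Ω
  simp only [avg_eq_sum, Finset.sum_sub_distrib, sub_div]

lemma avg_sum {I : Type*} (s : Finset I) (f : I → Ω → ℝ) :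
    avg (fun ω => ∑ i ∈ s, f i ω) = ∑ i ∈ s, avg (f i) := by
  have := Fintype.ofFinite Ω
  simp only [avg_eq_sum]
  rw [Finset.sum_comm, Finset.sum_div]

lemma avg_mono {f g : Ω → ℝ} (h : ∀ ω, f ω ≤ g ω) : avg f ≤ avg g := by
  have := Fintype.ofFinite Ω
  simp only [avg_eq_sum]
  gcongr
  exact h _

lemma avg_nonneg {f : Ω → ℝ} (h : ∀ ω, 0 ≤ f ω) : 0 ≤ avg f := by
  have := Fintype.ofFinite Ω
  rw [avg_eq_sum]
  exact div_nonneg (Finset.sum_nonneg fun ω _ => h ω) (Nat.cast_nonneg _)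

lemma avg_le_of_le [Nonempty Ω] {f : Ω → ℝ} {c : ℝ} (h : ∀ ω, f ω ≤ c) : avg f ≤ c :=
  (avg_mono h).trans_eq (avg_const c)

lemma abs_avg_le (f : Ω → ℝ) : |avg f| ≤ avg fun ω => |f ω| := by
  have := Fintype.ofFinite Ω
  simp only [avg_eq_sum]
  rw [abs_div, Nat.abs_cast]
  gcongr
  exact Finset.abs_sum_le_sum_abs _ _

lemma abs_avg_sub_avg_le {f g h : Ω → ℝ} (H : ∀ ω, |f ω - g ω| ≤ h ω) :
    |avg f - avg g| ≤ avg h := by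
  rw [← avg_sub]
  exact (abs_avg_le _).trans (avg_mono H)

lemma avg_prod (f : Ω × Ω' → ℝ) : avg f = avg fun a => avg fun b => f (a, b) := by
  have := Fintype.ofFinite Ω
  have := Fintype.ofFinite Ω'
  simp only [avg_eq_sum, Fintype.sum_prod_type, Fintype.card_prod, ← Finset.sum_div, Nat.cast_mul]
  rw [div_div, mul_comm]

lemma avg_comm (f : Ω → Ω' → ℝ) :
    (avg fun a => avg fun b => f a b) = avg fun b => avg fun a => f a b := by
  rw [← avg_prod (fun p : Ω × Ω' => f p.1 p.2), ← avg_prod (fun p : Ω' × Ω => f p.2 p.1)]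
  exact avg_congr_equiv (Equiv.prodComm Ω Ω') (fun p : Ω' × Ω => f p.2 p.1)

lemma avg_mem_unit [Nonempty Ω] {f : Ω → ℝ} (h0 : ∀ ω, 0 ≤ f ω) (h1 : ∀ ω, f ω ≤ 1) :
    0 ≤ avg f ∧ avg f ≤ 1 :=
  ⟨avg_nonneg h0, avg_le_of_le h1⟩

end Avg

lemma abs_sub_le_one {x y : ℝ} (hx : 0 ≤ x ∧ x ≤ 1) (hy : 0 ≤ y ∧ y ≤ 1) : |x - y| ≤ 1 := by
  rw [abs_le]; constructor <;> linarith [hx.1, hx.2, hy.1, hy.2]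

/-- If shifting the coins by `z` shifts `D` by `z`, then `D` is uniform. -/
lemma avg_ind_eq_of_shift {Ω G : Type*} [Finite Ω] [Nonempty Ω] [AddCommGroup G] [Finite G]
    (D : Ω → G) (e : G → Ω ≃ Ω) (he : ∀ z ω, D (e z ω) = D ω + z) (c : G) :
    (avg fun ω => ind (D ω = c)) = 1 / (Nat.card G : ℝ) := by
  classical
  have := Fintype.ofFinite G
  have key : ∀ z, (avg fun ω => ind (D ω = z)) = avg fun ω => ind (D ω = c) := by
    intro z
    rw [← avg_congr_equiv (e (z - c)) (fun ω => ind (D ω = z))]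
    congr 1; funext ω
    rw [he]
    congr 1
    exact propext ⟨fun h => by
      have := eq_sub_of_add_eq h
      simpa using this, fun h => by rw [h]; abel⟩
  have htot : ∑ z : G, (avg fun ω => ind (D ω = z)) = 1 := by
    rw [← avg_sum]
    have : ∀ ω, ∑ z : G, ind (D ω = z) = 1 := by
      intro ω; simp [ind]
    simp only [this, avg_const]
  simp only [key, Finset.sum_const, Finset.card_univ, nsmul_eq_mul] at htot
  rw [Nat.card_eq_fintype_card]
  have hc : (Fintype.card G : ℝ) ≠ 0 := by exact_mod_cast Fintype.card_ne_zero
  field_simp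
  linarith

/-- A uniformly random function has independent uniform values at distinct points. -/
lemma avg_comp_injective {A B I : Type*} [Finite A] [Finite B] [Finite I] [Nonempty B]
    (x : I → A) (hx : Function.Injective x) (φ : (I → B) → ℝ) :
    (avg fun f : A → B => φ (f ∘ x)) = avg φ := by
  classical
  let e : (A → B) ≃ (I → B) × ({a // a ∉ Set.range x} → B) :=
    ((Equiv.piEquivPiSubtypeProd (fun a => a ∈ Set.range x) (fun _ => B))).trans
      (Equiv.prodCongr (Equiv.arrowCongr (Equiv.ofInjective x hx).symm (Equiv.refl B))
        (Equiv.refl _))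
  have h1 : ∀ f : A → B, (e f).1 = f ∘ x := by
    intro f; funext i; simp [e]
  have h2 : (avg fun f : A → B => φ (f ∘ x)) = avg fun f : A → B => φ (e f).1 := by
    simp only [h1]
  rw [h2, avg_congr_equiv e (fun p => φ p.1), avg_prod]
  simp only [avg_const]

/-- Replacing one value of a uniformly random function by a fresh uniform one. -/
lemma avg_update {A B : Type*} [Finite A] [Finite B] [DecidableEq A] [Nonempty B] (s : A)
    (ψ : (A → B) → ℝ) :
    (avg fun v : B => avg fun g : A → B => ψ (Function.update g s v)) = avg ψ := by
  let e : B × (A → B) ≃ B × (A → B) :=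
    { toFun := fun p => (p.2 s, Function.update p.2 s p.1)
      invFun := fun p => (p.2 s, Function.update p.2 s p.1)
      left_inv := fun p => by simp
      right_inv := fun p => by simp }
  rw [← avg_prod (fun p : B × (A → B) => ψ (Function.update p.2 s p.1)),
    show (fun p : B × (A → B) => ψ (Function.update p.2 s p.1)) = fun p => ψ (e p).2 from rfl,
    avg_congr_equiv e (fun p => ψ p.2), avg_prod]
  simp only [avg_const]

lemma programmed_append_singleton {a : ℕ} {FF : Type*} (L : List (BitStr a × FF))
    (s : BitStr a) (v : FF) (g : BitStr a → FF) :
    programmed (L ++ [(s, v)]) g = programmed L (Function.update g s v) := by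
  funext x
  simp only [programmed, List.lookup_append]
  cases h : L.lookup x with
  | some y => simp
  | none =>
    by_cases hx : x = s
    · subst hx; simp [List.lookup]
    · simp [List.lookup, hx, beq_eq_false_iff_ne.mpr hx]

/-- Lazy sampling: the value at `s`, if `L` leaves it open, may be sampled beforehand. -/
lemma avg_programmed_append {a : ℕ} {FF : Type*} [Finite FF] [Nonempty FF]
    (L : List (BitStr a × FF)) (s : BitStr a) (ψ : (BitStr a → FF) → ℝ) :
    (avg fun v : FF => avg fun g => ψ (programmed (L ++ [(s, v)]) g)) =
      avg fun g => ψ (programmed L g) := by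
  simp only [programmed_append_singleton]
  exact avg_update s (fun g => ψ (programmed L g))

/-- A random function collides on two points only if they coincide or with probability `1/|G|`. -/
lemma avg_ind_apply_eq_le {A G : Type*} [Finite A] [AddCommGroup G] [Finite G] (x y : A) :
    (avg fun f : A → G => ind (f x = f y)) ≤ ind (x = y) + 1 / (Nat.card G : ℝ) := by
  classical
  by_cases h : x = y
  · subst h
    refine (avg_le_of_le (c := 1) fun f => ind_le_one _).trans ?_
    simp [ind]
  · have := avg_ind_eq_of_shift (fun f : A → G => f x - f y)
      (fun z => Equiv.addRight (Pi.single x z)) (fun z f => by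
        simp [Ne.symm h]; abel) 0
    simp only [sub_eq_zero] at this
    rw [this]
    linarith [ind_nonneg (x = y)]

/-! ### Boolean functions of an oracle that small circuits compute -/

/-- The final registers of a circuit started on the registers `reg`. -/
def Circuit.run {ι : Type} {a b : ℕ} (C : Circuit ι a b) (oracle : BitStr a → BitStr b)
    (input : ι → Bool) (reg : ℕ → Bool) : ℕ → Bool :=
  C.foldl (fun reg g => g.exec oracle input reg) reg

lemma Circuit.run_cons {ι : Type} {a b : ℕ} (g : Gate ι a b) (C : Circuit ι a b)
    (oracle : BitStr a → BitStr b) (input : ι → Bool) (reg : ℕ → Bool) :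
    Circuit.run (g :: C) oracle input reg = Circuit.run C oracle input (g.exec oracle input reg) :=
  rfl

lemma Circuit.run_append_singleton {ι : Type} {a b : ℕ} (g : Gate ι a b) (C : Circuit ι a b)
    (oracle : BitStr a → BitStr b) (input : ι → Bool) (reg : ℕ → Bool) :
    Circuit.run (C ++ [g]) oracle input reg = g.exec oracle input (C.run oracle input reg) := by
  simp [Circuit.run]

lemma Circuit.size_append_singleton {ι : Type} {a b : ℕ} (g : Gate ι a b) (C : Circuit ι a b) :
    Circuit.size (C ++ [g]) = C.size + g.cost := by
  simp [Circuit.size]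

lemma Circuit.length_le_size {ι : Type} {a b : ℕ} (C : Circuit ι a b) : C.length ≤ C.size := by
  induction C with
  | nil => simp
  | cons g C ih =>
    have : 1 ≤ g.cost := by cases g <;> simp [Gate.cost]; omega
    simp only [Circuit.size, List.map_cons, List.sum_cons, List.length_cons] at ih ⊢
    omega

/-- Boolean functions of an oracle. -/
abbrev OracleFn (a b : ℕ) : Type := (BitStr a → BitStr b) → Bool

/-- A single circuit of size at most `c` computes all functions of `X`, in distinguished registers
below some bound. -/
def Avail {a b : ℕ} (c : ℕ) (X : Set (OracleFn a b)) : Prop :=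
  ∃ (C : Circuit Empty a b) (N : ℕ), C.size ≤ c ∧
    ∀ f ∈ X, ∃ r < N, ∀ O, C.run O Empty.elim (fun _ => false) r = f O

namespace Avail

variable {a b c : ℕ} {X Y : Set (OracleFn a b)} {f g : OracleFn a b}

lemma empty : Avail 0 (∅ : Set (OracleFn a b)) :=
  ⟨[], 0, by simp [Circuit.size], by simp⟩

lemma mono {c' : ℕ} (h : Avail c X) (hY : Y ⊆ X) (hc : c ≤ c') : Avail c' Y := by
  obtain ⟨C, N, hC, hX⟩ := h
  exact ⟨C, N, hC.trans hc, fun f hf => hX f (hY hf)⟩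

lemma const (h : Avail c X) (v : Bool) : Avail (c + 1) (insert (fun _ => v) X) := by
  obtain ⟨C, N, hC, hX⟩ := h
  refine ⟨C ++ [.const N v], N + 1, ?_, ?_⟩
  · rw [Circuit.size_append_singleton]; simpa [Gate.cost] using hC
  · rintro f (rfl | hf)
    · exact ⟨N, by omega, fun O => by simp [Circuit.run_append_singleton, Gate.exec]⟩
    · obtain ⟨r, hr, h⟩ := hX f hf
      refine ⟨r, by omega, fun O => ?_⟩
      rw [Circuit.run_append_singleton, ← h O]
      simp [Gate.exec, hr.ne]

lemma nand (h : Avail c X) (hf : f ∈ X) (hg : g ∈ X) :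
    Avail (c + 1) (insert (fun O => !(f O && g O)) X) := by
  obtain ⟨C, N, hC, hX⟩ := h
  obtain ⟨rf, hrf, hf⟩ := hX f hf
  obtain ⟨rg, hrg, hg⟩ := hX g hg
  refine ⟨C ++ [.nand N rf rg], N + 1, ?_, ?_⟩
  · rw [Circuit.size_append_singleton]; simpa [Gate.cost] using hC
  · rintro f' (rfl | hf')
    · exact ⟨N, by omega, fun O => by simp [Circuit.run_append_singleton, Gate.exec, hf, hg]⟩
    · obtain ⟨r, hr, h⟩ := hX f' hf'
      refine ⟨r, by omega, fun O => ?_⟩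
      rw [Circuit.run_append_singleton, ← h O]
      simp [Gate.exec, hr.ne]

lemma query (h : Avail c X) (src : Fin a → OracleFn a b) (hs : ∀ i, src i ∈ X) :
    Avail (c + (1 + a + b)) (X ∪ Set.range fun t O => O (fun i => src i O) t) := by
  obtain ⟨C, N, hC, hX⟩ := h
  choose r hr hrs using fun i => hX (src i) (hs i)
  refine ⟨C ++ [.query N r], N + b, ?_, ?_⟩
  · rw [Circuit.size_append_singleton]; simpa [Gate.cost] using hC
  · rintro f (hf | ⟨t, rfl⟩)
    · obtain ⟨r', hr', h⟩ := hX f hf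
      refine ⟨r', by omega, fun O => ?_⟩
      rw [Circuit.run_append_singleton, ← h O]
      simp [Gate.exec, hr'.not_ge]
    · refine ⟨N + t, by omega, fun O => ?_⟩
      rw [Circuit.run_append_singleton]
      simp [Gate.exec, hrs]

/-- A computed function is decided by a circuit. -/
lemma exists_circuit (h : Avail c X) (hf : f ∈ X) :
    ∃ C : Circuit Empty a b, C.size ≤ c + 2 ∧ ∀ O, C.accepts O Empty.elim ↔ f O = true := by
  obtain ⟨C, N, hC, hX⟩ := h
  obtain ⟨r, hr, h⟩ := hX f hf
  refine ⟨(C ++ [.nand N r r]) ++ [.nand 0 N N], ?_, fun O => ?_⟩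
  · simp only [Circuit.size_append_singleton, Gate.cost]; omega
  · change (Circuit.run (C ++ [.nand N r r] ++ [.nand 0 N N]) O Empty.elim fun _ => false) 0 =
      true ↔ _
    simp only [Circuit.run_append_singleton, Gate.exec, Function.update_self, h]
    simp

lemma not (h : Avail c X) (hf : f ∈ X) : Avail (c + 1) (insert (fun O => !(f O)) X) := by
  simpa using h.nand hf hf

lemma and (h : Avail c X) (hf : f ∈ X) (hg : g ∈ X) :
    Avail (c + 2) (insert (fun O => f O && g O) X) := by
  have := (h.nand hf hg).not (Set.mem_insert _ _)
  simp only [Bool.not_not] at this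
  exact this.mono (Set.insert_subset_insert (Set.subset_insert _ _)) le_rfl

lemma beq (h : Avail c X) (hf : f ∈ X) (hg : g ∈ X) :
    Avail (c + 5) (insert (fun O => f O == g O) X) := by
  have h1 := h.nand hf hg
  have h2 := h1.not (Or.inr hf)
  have h3 := h2.not (Or.inr (Or.inr hg))
  have h4 := h3.nand (Or.inl rfl) (Or.inr (Or.inl rfl))
  have h5 := h4.nand (Or.inl rfl) (Or.inr (Or.inr (Or.inr (Or.inl rfl))))
  refine h5.mono ?_ le_rfl
  rintro k (rfl | hk)
  · left; funext O; cases f O <;> cases g O <;> rfl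
  · simp [hk]

lemma ite {e : OracleFn a b} (h : Avail c X) (he : e ∈ X) (hf : f ∈ X) (hg : g ∈ X) :
    Avail (c + 4) (insert (fun O => if e O then f O else g O) X) := by
  have h1 := h.nand he hf
  have h2 := h1.not (Or.inr he)
  have h3 := h2.nand (Or.inl rfl) (Or.inr (Or.inr hg))
  have h4 := h3.nand (Or.inl rfl) (Or.inr (Or.inr (Or.inl rfl)))
  refine h4.mono ?_ le_rfl
  rintro k (rfl | hk)
  · left; funext O; cases e O <;> cases f O <;> cases g O <;> rfl
  · simp [hk]

/-- Computing a family of functions one by one. -/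
lemma family {I : Type*} (f : I → OracleFn a b) (w : ℕ) {B : Set (OracleFn a b)} (l : List I)
    (hstep : ∀ t c X, B ⊆ X → Avail c X → Avail (c + w) (insert (f t) X))
    (hB : B ⊆ X) (h : Avail c X) : Avail (c + l.length * w) (X ∪ {k | ∃ t ∈ l, k = f t}) := by
  induction l generalizing c X with
  | nil => exact h.mono (by simp) (by simp)
  | cons t l ih =>
    refine (ih (hB.trans (Set.subset_insert (f t) X)) (hstep t c X hB h)).mono ?_ ?_
    · rintro k (hk | ⟨s, hs, rfl⟩)
      · exact Or.inl (Or.inr hk)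
      · rcases List.mem_cons.1 hs with rfl | hs
        · exact Or.inl (Or.inl rfl)
        · exact Or.inr ⟨s, hs, rfl⟩
    · rw [List.length_cons, Nat.add_mul]; omega

lemma familyFin {n : ℕ} (f : Fin n → OracleFn a b) (w : ℕ) {B : Set (OracleFn a b)}
    (hstep : ∀ t c X, B ⊆ X → Avail c X → Avail (c + w) (insert (f t) X))
    (hB : B ⊆ X) (h : Avail c X) : Avail (c + n * w) (X ∪ Set.range f) := by
  refine (family f w (List.finRange n) hstep hB h).mono ?_ (by simp)
  rintro k (hk | ⟨t, rfl⟩)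
  · exact Or.inl hk
  · exact Or.inr ⟨t, List.mem_finRange t, rfl⟩

/-- Comparing two strings. -/
lemma beqVec {n : ℕ} {x y : Fin n → OracleFn a b} (hx : ∀ i, x i ∈ X) (hy : ∀ i, y i ∈ X)
    (h : Avail c X) :
    Avail (c + (1 + n * 7))
      (insert (fun O => (fun i => x i O : BitStr n) == (fun i => y i O)) X) := by
  have key : ∀ l : List (Fin n), Avail (c + (1 + l.length * 7))
      (insert (fun O => l.all fun i => x i O == y i O) X) := by
    intro l
    induction l with
    | nil => simpa using h.const true
    | cons i l ih =>
      have h1 := ih.beq (Or.inr (hx i)) (Or.inr (hy i))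
      have h2 := h1.and (Or.inl rfl) (Or.inr (Or.inl rfl))
      refine h2.mono ?_ (by rw [List.length_cons]; omega)
      rintro k (rfl | hk)
      · left; funext O; simp
      · simp [hk]
  refine (key (List.finRange n)).mono ?_ (by simp)
  rintro k (rfl | hk)
  · left; funext O
    rw [Bool.eq_iff_iff]
    simp [funext_iff]
  · simp [hk]

end Avail

/-- The key-value table with the keys given by the oracle functions. -/
def evalTable {a b a' : ℕ} {FF : Type*} (T : List ((Fin a' → OracleFn a b) × FF))
    (O : BitStr a → BitStr b) : List (BitStr a' × FF) :=
  T.map fun e => (fun i => e.1 i O, e.2)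

/-- The bits of the table entry for the key `s`, and `0` when there is none. -/
def lookupBit {a b a' ℓ : ℕ} {FF : Type*} (enc : FF → BitStr ℓ)
    (T : List ((Fin a' → OracleFn a b) × FF)) (s : Fin a' → OracleFn a b) (t : Fin ℓ) :
    OracleFn a b :=
  fun O => (((evalTable T O).lookup (fun i => s i O)).map fun v => enc v t).getD false

lemma Avail.lookup {a b a' ℓ c : ℕ} {FF : Type*} {X : Set (OracleFn a b)} (enc : FF → BitStr ℓ)
    (T : List ((Fin a' → OracleFn a b) × FF)) (s : Fin a' → OracleFn a b)
    (hconst : ∀ v : Bool, (fun _ => v) ∈ X) (hs : ∀ i, s i ∈ X) (hT : ∀ e ∈ T, ∀ i, e.1 i ∈ X)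
    (h : Avail c X) :
    Avail (c + T.length * (1 + a' * 7 + ℓ * 4)) (X ∪ Set.range (lookupBit enc T s)) := by
  induction T with
  | nil =>
    refine h.mono ?_ (by simp)
    rintro k (hk | ⟨t, rfl⟩)
    · exact hk
    · exact hconst false
  | cons e T ih =>
    obtain ⟨k, v⟩ := e
    have h1 := ih fun e he => hT e (List.mem_cons_of_mem _ he)
    have h2 := h1.beqVec (x := s) (y := k) (fun i => Or.inl (hs i))
      (fun i => Or.inl (hT _ List.mem_cons_self i))
    have h3 := h2.familyFin (lookupBit enc ((k, v) :: T) s) 4 (fun t c Y hY hA => by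
      have := hA.ite (hY (Set.mem_insert _ _)) (hY (Or.inr (Or.inl (hconst (enc v t)))))
        (hY (Or.inr (Or.inr ⟨t, rfl⟩)))
      refine this.mono ?_ le_rfl
      rintro f (rfl | hf)
      · left; funext O
        simp only [lookupBit, evalTable, List.map_cons, List.lookup_cons]
        cases ((fun i => s i O : BitStr a') == fun i => k i O) <;> simp
      · exact Or.inr hf) subset_rfl
    refine h3.mono ?_ (by rw [List.length_cons, Nat.add_mul]; omega)
    rintro f (hf | hf)
    · exact Or.inl (Or.inr (Or.inl hf))
    · exact Or.inr hf

/-- Simulation of a random programmed oracle by lazy sampling: if a property of oracle functionals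
holds for all small circuits and is stable under averaging, then it holds for the acceptance
probability of a circuit with a random programmed oracle whose inputs are computed by small
circuits. -/
lemma lazy_sampling {a₀ b₀ a ℓ S M : ℕ} {ι : Type} {FF : Type} [Finite FF] [Nonempty FF]
    (Good : ((BitStr a₀ → BitStr b₀) → ℝ) → Prop)
    (havg : ∀ φ : FF → (BitStr a₀ → BitStr b₀) → ℝ, (∀ v, Good (φ v)) →
      Good fun O => avg fun v => φ v O)
    (hcirc : ∀ C : Circuit Empty a₀ b₀, C.size ≤ S → Good fun O => ind (C.accepts O Empty.elim))
    (enc : FF → BitStr ℓ) (input : ι → OracleFn a₀ b₀) (D : Circuit ι a ℓ)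
    (T : List ((Fin a → OracleFn a₀ b₀) × FF)) (reg : ℕ → OracleFn a₀ b₀)
    (X : Set (OracleFn a₀ b₀)) (c : ℕ) (h : Avail c X) (hconst : ∀ v : Bool, (fun _ => v) ∈ X)
    (hinput : ∀ i, input i ∈ X) (hreg : ∀ s, reg s ∈ X) (hT : ∀ e ∈ T, ∀ i, e.1 i ∈ X)
    (hM : T.length + D.length ≤ M)
    (hS : c + D.length * (1 + M * (1 + a * 7 + ℓ * 4)) + 2 ≤ S) :
    Good fun O => avg fun g : BitStr a → FF =>
      ind (D.run (fun s => enc (programmed (evalTable T O) g s)) (fun i => input i O)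
        (fun s => reg s O) 0 = true) := by
  induction D generalizing T reg X c with
  | nil =>
    simp only [Circuit.run, List.foldl_nil, avg_const]
    obtain ⟨C, hC, hacc⟩ := h.exists_circuit (hreg 0)
    simp only [← hacc]
    exact hcirc C (hC.trans (by simpa using hS))
  | cons gt D ih =>
    rw [List.length_cons, Nat.add_mul] at hS
    rw [List.length_cons] at hM
    simp only [Circuit.run_cons]
    cases gt with
    | const dst v =>
      have e : ∀ O (o : BitStr a → BitStr ℓ), (Gate.const dst v).exec o (fun i => input i O)
          (fun s => reg s O) = fun s => Function.update reg dst (fun _ => v) s O := by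
        intro O o; funext s
        by_cases hs : s = dst
        · subst hs; simp [Gate.exec]
        · simp [Gate.exec, hs]
      simp only [e]
      refine ih T _ X c h hconst hinput (fun s => ?_) hT (by omega) (by omega)
      by_cases hs : s = dst
      · subst hs; simpa using hconst v
      · simpa [hs] using hreg s
    | load dst i =>
      have e : ∀ O (o : BitStr a → BitStr ℓ), (Gate.load dst i).exec o (fun i => input i O)
          (fun s => reg s O) = fun s => Function.update reg dst (input i) s O := by
        intro O o; funext s
        by_cases hs : s = dst
        · subst hs; simp [Gate.exec]
        · simp [Gate.exec, hs]
      simp only [e]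
      refine ih T _ X c h hconst hinput (fun s => ?_) hT (by omega) (by omega)
      by_cases hs : s = dst
      · subst hs; simpa using hinput i
      · simpa [hs] using hreg s
    | nand dst x y =>
      have e : ∀ O (o : BitStr a → BitStr ℓ), (Gate.nand dst x y).exec o (fun i => input i O)
          (fun s => reg s O) =
            fun s => Function.update reg dst (fun O => !(reg x O && reg y O)) s O := by
        intro O o; funext s
        by_cases hs : s = dst
        · subst hs; simp [Gate.exec]
        · simp [Gate.exec, hs]
      simp only [e]
      refine ih T _ _ (c + 1) (h.nand (hreg x) (hreg y)) (fun v => Or.inr (hconst v))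
        (fun i => Or.inr (hinput i)) (fun s => ?_) (fun e he i => Or.inr (hT e he i)) (by omega)
        (by omega)
      by_cases hs : s = dst
      · subst hs; simp
      · simpa [hs] using Or.inr (hreg s)
    | query dst src =>
      let T' : FF → List ((Fin a → OracleFn a₀ b₀) × FF) :=
        fun v => T ++ [(fun i => reg (src i), v)]
      have hT' : ∀ v, ∀ e ∈ T' v, ∀ i, e.1 i ∈ X := by
        intro v e he i
        rcases List.mem_append.1 he with he | he
        · exact hT e he i
        · rw [List.mem_singleton.1 he]; exact hreg _
      have hlen : ∀ v, (T' v).length = T.length + 1 := fun v => by simp [T']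
      let reg' : FF → ℕ → OracleFn a₀ b₀ := fun v s =>
        if h : dst ≤ s ∧ s - dst < ℓ then
          lookupBit enc (T' v) (fun i => reg (src i)) ⟨s - dst, h.2⟩
        else reg s
      have ev : ∀ O v, evalTable (T' v) O =
          evalTable T O ++ [(fun i => reg (src i) O, v)] := fun O v => by simp [T', evalTable]
      have e : ∀ O v g, (Gate.query dst src).exec
          (fun s => enc (programmed (evalTable (T' v) O) g s)) (fun i => input i O)
          (fun s => reg s O) = fun s => reg' v s O := by
        intro O v g; funext s
        simp only [Gate.exec, reg']
        split_ifs with hs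
        · have : (evalTable (T' v) O).lookup (fun i => reg (src i) O) ≠ none := by
            rw [ev, List.lookup_append]
            cases List.lookup (fun i => reg (src i) O) (evalTable T O) <;> simp [List.lookup]
          obtain ⟨y, hy⟩ := Option.ne_none_iff_exists'.1 this
          simp [lookupBit, programmed, hy]
        · rfl
      have key : ∀ O, (avg fun g : BitStr a → FF =>
          ind (Circuit.run D (fun s => enc (programmed (evalTable T O) g s)) (fun i => input i O)
            ((Gate.query dst src).exec (fun s => enc (programmed (evalTable T O) g s))
              (fun i => input i O) fun s => reg s O) 0 = true)) =
          avg fun v => avg fun g : BitStr a → FF =>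
            ind (Circuit.run D (fun s => enc (programmed (evalTable (T' v) O) g s)) (fun i => input i O)
              (fun s => reg' v s O) 0 = true) := by
        intro O
        rw [← avg_programmed_append (evalTable T O) (fun i => reg (src i) O) (fun p =>
          ind (Circuit.run D (fun s => enc (p s)) (fun i => input i O)
            ((Gate.query dst src).exec (fun s => enc (p s))
              (fun i => input i O) fun s => reg s O) 0 = true))]
        simp only [← ev, e]
      simp only [key]
      refine havg _ fun v => ?_
      have hav := h.lookup enc (T' v) (fun i => reg (src i)) hconst (fun i => hreg _) (hT' v)
      have hle : (T' v).length * (1 + a * 7 + ℓ * 4) ≤ M * (1 + a * 7 + ℓ * 4) :=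
        Nat.mul_le_mul_right _ (by rw [hlen]; omega)
      refine ih (T' v) (reg' v) _ _ hav (fun v => Or.inl (hconst v)) (fun i => Or.inl (hinput i))
        (fun s => ?_) (fun e he i => Or.inl (hT' v e he i)) (by rw [hlen]; omega) (by omega)
      simp only [reg']
      split_ifs with hs
      · exact Or.inr ⟨_, rfl⟩
      · exact Or.inl (hreg s)

/-! ### The local mapping -/

section Intervals

variable {FF : Type*} {m : ℕ} {δ : ℕ}

/-- Induction along the merging loop of `insertInterval`. -/
lemma insertInterval_induction {x : ℤ} {r : FF} {L : IntervalList FF}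
    (Inv : Finset ℤ → IntervalList FF → IntervalList FF → Prop)
    (h0 : Inv (Finset.Icc (x - δ) (x + δ)) [] L)
    (hmerge : ∀ U K e R, Inv U K (e :: R) → (U ∩ e.1).Nonempty → Inv (U ∪ e.1) K R)
    (hkeep : ∀ U K e R, Inv U K (e :: R) → Disjoint U e.1 → Inv U (K ++ [e]) R) :
    ∃ U K, Inv U K [] ∧ insertInterval δ x r L = K ++ [(U, r)] := by
  have key : ∀ (R : IntervalList FF) (acc : Finset ℤ × IntervalList FF), Inv acc.1 acc.2 R →
      Inv (R.foldl (fun (acc : Finset ℤ × IntervalList FF) e =>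
          if (acc.1 ∩ e.1).Nonempty then (acc.1 ∪ e.1, acc.2) else (acc.1, acc.2 ++ [e])) acc).1
        (R.foldl (fun (acc : Finset ℤ × IntervalList FF) e =>
          if (acc.1 ∩ e.1).Nonempty then (acc.1 ∪ e.1, acc.2) else (acc.1, acc.2 ++ [e])) acc).2
        [] := by
    intro R
    induction R with
    | nil => intro acc h; exact h
    | cons e R ih =>
      intro acc h
      rw [List.foldl_cons]
      apply ih
      split_ifs with hne
      · exact hmerge _ _ _ _ h hne
      · refine hkeep _ _ _ _ h ?_
        rwa [Finset.disjoint_iff_inter_eq_empty, ← Finset.not_nonempty_iff_eq_empty]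
  exact ⟨_, _, key L (_, []) h0, rfl⟩

/-- Induction along the insertions. -/
lemma intervals_induction (x : Fin m → ℤ) (r : Fin m → FF)
    (P : List (Fin m) → IntervalList FF → Prop) (h0 : P [] [])
    (hstep : ∀ l j L, P l L → P (l ++ [j]) (insertInterval δ (x j) (r j) L)) :
    P (List.finRange m) (intervals δ x r) := by
  unfold intervals
  induction List.finRange m using List.reverseRecOn with
  | nil => exact h0
  | append_singleton l j ih =>
    rw [List.foldl_append]
    exact hstep _ _ _ ih

lemma intervals_pairwise (x : Fin m → ℤ) (r : Fin m → FF) :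
    (intervals δ x r).Pairwise fun e e' => Disjoint e.1 e'.1 := by
  refine intervals_induction x r (fun _ L => L.Pairwise fun e e' => Disjoint e.1 e'.1) (by simp) ?_
  intro _ j L hL
  obtain ⟨U, K, ⟨h1, h2⟩, h⟩ := insertInterval_induction (δ := δ) (x := x j) (r := r j) (L := L)
    (fun U K R => (K ++ R).Pairwise (fun e e' => Disjoint e.1 e'.1) ∧ ∀ e ∈ K, Disjoint U e.1)
    ⟨by simpa using hL, by simp⟩
    (by
      rintro U K e R ⟨h1, h2⟩ -
      rw [List.pairwise_append] at h1
      refine ⟨List.pairwise_append.2 ⟨h1.1, (List.pairwise_cons.1 h1.2.1).2,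
        fun a ha b hb => h1.2.2 a ha b (List.mem_cons_of_mem _ hb)⟩, fun a ha => ?_⟩
      exact Finset.disjoint_union_left.2 ⟨h2 a ha, (h1.2.2 a ha e List.mem_cons_self).symm⟩)
    (by
      rintro U K e R ⟨h1, h2⟩ hd
      refine ⟨by simpa using h1, fun a ha => ?_⟩
      rcases List.mem_append.1 ha with ha | ha
      · exact h2 a ha
      · rwa [List.mem_singleton.1 ha])
  rw [h, List.pairwise_append]
  rw [List.append_nil] at h1
  refine ⟨h1, by simp, fun a ha b hb => ?_⟩
  rw [List.mem_singleton.1 hb]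
  exact (h2 a ha).symm

lemma eq_of_mem_intervals {x : Fin m → ℤ} {r : Fin m → FF} {e e' : Finset ℤ × FF} {y : ℤ}
    (he : e ∈ intervals δ x r) (he' : e' ∈ intervals δ x r) (hy : y ∈ e.1) (hy' : y ∈ e'.1) :
    e = e' := by
  by_contra hne
  have : Std.Symm fun e e' : Finset ℤ × FF => Disjoint e.1 e'.1 := ⟨fun _ _ h => h.symm⟩
  have := (intervals_pairwise (δ := δ) x r).forall he he' hne
  exact Finset.disjoint_left.1 this hy hy'

lemma exists_mem_intervals_of_index (x : Fin m → ℤ) (r : Fin m → FF) (j : Fin m) :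
    ∃ e ∈ intervals δ x r, Finset.Icc (x j - δ) (x j + δ) ⊆ e.1 := by
  refine intervals_induction x r
    (fun l L => ∀ j ∈ l, ∃ e ∈ L, Finset.Icc (x j - δ) (x j + δ) ⊆ e.1) (by simp) ?_ j
    (List.mem_finRange j)
  intro l j L hL
  obtain ⟨U, K, ⟨h1, h2⟩, h⟩ := insertInterval_induction (δ := δ) (x := x j) (r := r j) (L := L)
    (fun U K R => Finset.Icc (x j - δ) (x j + δ) ⊆ U ∧ ∀ e ∈ L, e.1 ⊆ U ∨ e ∈ K ∨ e ∈ R)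
    ⟨subset_rfl, fun e he => Or.inr (Or.inr he)⟩
    (by
      rintro U K e R ⟨h1, h2⟩ -
      refine ⟨h1.trans Finset.subset_union_left, fun a ha => ?_⟩
      rcases h2 a ha with h | h | h
      · exact Or.inl (h.trans Finset.subset_union_left)
      · exact Or.inr (Or.inl h)
      · rcases List.mem_cons.1 h with rfl | h
        · exact Or.inl Finset.subset_union_right
        · exact Or.inr (Or.inr h))
    (by
      rintro U K e R ⟨h1, h2⟩ -
      refine ⟨h1, fun a ha => ?_⟩
      have := h2 a ha
      simp only [List.mem_cons, List.mem_append] at this ⊢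
      tauto)
  rw [h]
  intro j' hj'
  rcases List.mem_append.1 hj' with hj' | hj'
  · obtain ⟨e, he, hsub⟩ := hL j' hj'
    rcases h2 e he with h | h | h
    · exact ⟨(U, r j), by simp, hsub.trans h⟩
    · exact ⟨e, by simp [h], hsub⟩
    · simp at h
  · rw [List.mem_singleton.1 hj']
    exact ⟨(U, r j), by simp, h1⟩

lemma forall_mem_intervals (x : Fin m → ℤ) (r : Fin m → FF) (p : ℤ → Prop)
    (hp : ∀ j, ∀ y ∈ Finset.Icc (x j - δ) (x j + δ), p y) :
    ∀ e ∈ intervals δ x r, ∀ y ∈ e.1, p y := by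
  refine intervals_induction x r (fun _ L => ∀ e ∈ L, ∀ y ∈ e.1, p y) (by simp) ?_
  intro l j L hL
  obtain ⟨U, K, ⟨h1, h2, -⟩, h⟩ := insertInterval_induction (δ := δ) (x := x j) (r := r j) (L := L)
    (fun U K R => (∀ y ∈ U, p y) ∧ (∀ e ∈ K, ∀ y ∈ e.1, p y) ∧ ∀ e ∈ R, ∀ y ∈ e.1, p y)
    ⟨hp j, by simp, hL⟩
    (by
      rintro U K e R ⟨h1, h2, h3⟩ -
      refine ⟨fun y hy => ?_, h2, fun a ha => h3 a (List.mem_cons_of_mem _ ha)⟩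
      rcases Finset.mem_union.1 hy with hy | hy
      · exact h1 y hy
      · exact h3 e List.mem_cons_self y hy)
    (by
      rintro U K e R ⟨h1, h2, h3⟩ -
      refine ⟨h1, fun a ha => ?_, fun a ha => h3 a (List.mem_cons_of_mem _ ha)⟩
      rcases List.mem_append.1 ha with ha | ha
      · exact h2 a ha
      · rw [List.mem_singleton.1 ha]; exact h3 e List.mem_cons_self)
  rw [h]
  intro e he
  rcases List.mem_append.1 he with he | he
  · exact h2 e he
  · rw [List.mem_singleton.1 he]; exact h1

lemma sum_card_intervals_le (x : Fin m → ℤ) (r : Fin m → FF) :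
    ((intervals δ x r).map fun e => e.1.card).sum ≤ m * (2 * δ + 1) := by
  have := intervals_induction (δ := δ) x r
    (fun l L => (L.map fun e => e.1.card).sum ≤ l.length * (2 * δ + 1)) (by simp) ?_
  · simpa using this
  intro l j L hL
  obtain ⟨U, K, h1, h⟩ := insertInterval_induction (δ := δ) (x := x j) (r := r j) (L := L)
    (fun U K R => U.card + (K.map fun e => e.1.card).sum + (R.map fun e => e.1.card).sum ≤
      (2 * δ + 1) + (L.map fun e => e.1.card).sum)
    (by simp only [Int.card_Icc, List.map_nil, List.sum_nil]; omega)
    (by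
      rintro U K e R h -
      have := Finset.card_union_le U e.1
      simp only [List.map_cons, List.sum_cons] at h
      omega)
    (by
      rintro U K e R h -
      simp only [List.map_cons, List.sum_cons] at h
      simp only [List.map_append, List.map_cons, List.map_nil, List.sum_append, List.sum_cons,
        List.sum_nil]
      omega)
  rw [h]
  simp only [List.map_append, List.map_cons, List.map_nil, List.sum_append, List.sum_cons,
    List.sum_nil, List.length_append, List.length_singleton, Nat.add_mul] at h1 ⊢
  omega

/-- The interval lists depend on the sampled values only through the final labels. -/
lemma intervals_map {G : Type*} (x : Fin m → ℤ) (r : Fin m → FF) (φ : FF → G) :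
    intervals δ x (fun j => φ (r j)) = (intervals δ x r).map (Prod.map id φ) := by
  have key : ∀ (R : IntervalList FF) (U : Finset ℤ) (K : IntervalList FF),
      (R.map (Prod.map id φ)).foldl (fun (acc : Finset ℤ × IntervalList G) e =>
          if (acc.1 ∩ e.1).Nonempty then (acc.1 ∪ e.1, acc.2) else (acc.1, acc.2 ++ [e]))
          (U, K.map (Prod.map id φ)) =
        Prod.map id (List.map (Prod.map id φ))
          (R.foldl (fun (acc : Finset ℤ × IntervalList FF) e =>
          if (acc.1 ∩ e.1).Nonempty then (acc.1 ∪ e.1, acc.2) else (acc.1, acc.2 ++ [e]))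
          (U, K)) := by
    intro R
    induction R with
    | nil => intro U K; rfl
    | cons e R ih =>
      intro U K
      simp only [List.map_cons, List.foldl_cons, Prod.map_fst, id]
      split_ifs
      · exact ih _ _
      · rw [← ih]; simp
  have ins : ∀ (z : ℤ) (v : FF) (L : IntervalList FF),
      insertInterval δ z (φ v) (L.map (Prod.map id φ)) =
        (insertInterval δ z v L).map (Prod.map id φ) := by
    intro z v L
    have := key L (Finset.Icc (z - δ) (z + δ)) []
    simp only [List.map_nil] at this
    simp [insertInterval, this]
  unfold intervals
  induction List.finRange m using List.reverseRecOn with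
  | nil => rfl
  | append_singleton l j ih =>
    rw [List.foldl_append, List.foldl_append, ih]
    exact ins _ _ _

/-- The interval of an isolated point is never merged. -/
lemma mem_intervals_of_isolated (x : Fin m → ℤ) (i : Fin m)
    (hi : ∀ j, j ≠ i →
      Disjoint (Finset.Icc (x j - δ) (x j + δ)) (Finset.Icc (x i - δ) (x i + δ))) :
    ∀ e ∈ intervals δ x (fun j => j), (e.2 = i ∧ e.1 = Finset.Icc (x i - δ) (x i + δ)) ∨
      (e.2 ≠ i ∧ Disjoint e.1 (Finset.Icc (x i - δ) (x i + δ))) := by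
  set I := Finset.Icc (x i - δ) (x i + δ) with hI
  refine intervals_induction x (fun j => j)
    (fun _ L => ∀ e ∈ L, (e.2 = i ∧ e.1 = I) ∨ (e.2 ≠ i ∧ Disjoint e.1 I)) (by simp) ?_
  intro l j L hL
  obtain ⟨U, K, ⟨h1, h2, -⟩, h⟩ := insertInterval_induction (δ := δ) (x := x j) (r := j) (L := L)
    (fun U K R => ((j = i ∧ U = I) ∨ (j ≠ i ∧ Disjoint U I)) ∧
      (∀ e ∈ K, (e.2 = i ∧ e.1 = I) ∨ (e.2 ≠ i ∧ Disjoint e.1 I)) ∧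
      ∀ e ∈ R, (e.2 = i ∧ e.1 = I) ∨ (e.2 ≠ i ∧ Disjoint e.1 I))
    ⟨by
      by_cases hj : j = i
      · subst hj; exact Or.inl ⟨rfl, rfl⟩
      · exact Or.inr ⟨hj, hi j hj⟩, by simp, hL⟩
    (by
      rintro U K e R ⟨h1, h2, h3⟩ hne
      refine ⟨?_, h2, fun a ha => h3 a (List.mem_cons_of_mem _ ha)⟩
      have hnd : ¬ Disjoint U e.1 := by
        rwa [Finset.disjoint_iff_inter_eq_empty, ← Finset.not_nonempty_iff_eq_empty, not_not]
      rcases h1 with ⟨hj, hU⟩ | ⟨hj, hU⟩ <;>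
        rcases h3 e List.mem_cons_self with ⟨-, he⟩ | ⟨-, he⟩
      · left; exact ⟨hj, by rw [hU, he, Finset.union_self]⟩
      · exact absurd (by rw [hU]; exact he.symm) hnd
      · exact absurd (by rw [he]; exact hU) hnd
      · exact Or.inr ⟨hj, Finset.disjoint_union_left.2 ⟨hU, he⟩⟩)
    (by
      rintro U K e R ⟨h1, h2, h3⟩ -
      refine ⟨h1, fun a ha => ?_, fun a ha => h3 a (List.mem_cons_of_mem _ ha)⟩
      rcases List.mem_append.1 ha with ha | ha
      · exact h2 a ha
      · rw [List.mem_singleton.1 ha]; exact h3 e List.mem_cons_self)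
  rw [h]
  intro e he
  rcases List.mem_append.1 he with he | he
  · exact h2 e he
  · rw [List.mem_singleton.1 he]; exact h1

lemma valueAt_of_mem [Zero FF] {x : Fin m → ℤ} {r : Fin m → FF} {e : Finset ℤ × FF} {y : ℤ}
    (he : e ∈ intervals δ x r) (hy : y ∈ e.1) : valueAt (intervals δ x r) y = e.2 := by
  unfold valueAt
  cases h : (intervals δ x r).find? fun e => decide (y ∈ e.1) with
  | none => exact absurd hy (by simpa using List.find?_eq_none.1 h e he)
  | some e' =>
    have h1 := List.mem_of_find?_eq_some h
    have h2 : y ∈ e'.1 := by simpa using List.find?_some h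
    rw [eq_of_mem_intervals h1 he h2 hy]

lemma mem_Icc_self_sub_add (y : ℤ) : y ∈ Finset.Icc (y - δ) (y + δ) := by
  rw [Finset.mem_Icc]; omega

/-- The value at the `j`-th point is the one sampled for some index `ρ j`; an isolated point gets
its own value, which no other point gets. -/
lemma exists_valueAt_eq [Zero FF] (x : Fin m → ℤ) :
    ∃ ρ : Fin m → Fin m, (∀ (r : Fin m → FF) j, valueAt (intervals δ x r) (x j) = r (ρ j)) ∧
      ∀ i, (∀ j, j ≠ i →
          Disjoint (Finset.Icc (x j - δ) (x j + δ)) (Finset.Icc (x i - δ) (x i + δ))) →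
        ∀ j, ρ j = i ↔ j = i := by
  choose e he hsub using exists_mem_intervals_of_index (δ := δ) x (fun j => j)
  refine ⟨fun j => (e j).2, fun r j => ?_, fun i hi j => ⟨fun h => ?_, ?_⟩⟩
  · have hmem : Prod.map id r (e j) ∈ intervals δ x r := by
      rw [show intervals δ x r = _ from intervals_map x (fun j => j) r]
      exact List.mem_map_of_mem (he j)
    exact valueAt_of_mem hmem (hsub j (mem_Icc_self_sub_add _))
  · by_contra hj
    rcases mem_intervals_of_isolated x i hi (e j) (he j) with ⟨-, h1⟩ | ⟨h1, -⟩
    · exact Finset.disjoint_left.1 (hi j hj) (mem_Icc_self_sub_add _)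
        (h1 ▸ hsub j (mem_Icc_self_sub_add _))
    · exact h1 h
  · rintro rfl
    rcases mem_intervals_of_isolated x j hi (e j) (he j) with ⟨h1, -⟩ | ⟨-, h1⟩
    · exact h1
    · exact absurd (mem_Icc_self_sub_add _)
        (Finset.disjoint_left.1 h1 (hsub j (mem_Icc_self_sub_add _)))

end Intervals

/-- Shifting the value that one point sampled in its isolated dimension shifts its identifier and
leaves the one of another point unchanged. -/
lemma exists_pid_shift {FF : Type*} [AddCommGroup FF] {m d u δ : ℕ} {Q : Input m d u}
    (hQ : DisjointProjection δ Q) {j j' : Fin m} (hj : j ≠ j') :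
    ∃ e : FF → (Fin m → Fin d → FF) ≃ (Fin m → Fin d → FF), ∀ z r,
      pid δ Q.toInt (e z r) j = pid δ Q.toInt r j + z ∧
        pid δ Q.toInt (e z r) j' = pid δ Q.toInt r j' := by
  classical
  choose ρ hρ hiso using fun k => exists_valueAt_eq (FF := FF) (δ := δ) fun i => Q.toInt i k
  obtain ⟨k, hk⟩ := hQ j
  have hk' := hiso k j fun i hi => by
    rw [← Finset.disjoint_coe, Finset.coe_Icc, Finset.coe_Icc, disjoint_comm,
      Set.disjoint_iff_inter_eq_empty]
    exact hk i hi
  have hpid : ∀ (r : Fin m → Fin d → FF) i, pid δ Q.toInt r i = ∑ k, r (ρ k i) k := by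
    intro r i
    refine Finset.sum_congr rfl fun k _ => ?_
    exact hρ k (fun i => r i k) i
  refine ⟨fun z => Equiv.addRight (Pi.single j (Pi.single k z)), fun z r => ⟨?_, ?_⟩⟩
  · simp only [hpid, Equiv.coe_addRight, Pi.add_apply, Finset.sum_add_distrib, add_right_inj]
    rw [Finset.sum_eq_single k]
    · rw [(hk' j).2 rfl]; simp
    · intro k' _ hne
      by_cases h : ρ k' j = j
      · rw [h]; simp [hne]
      · simp [h]
    · simp
  · simp only [hpid, Equiv.coe_addRight, Pi.add_apply, Finset.sum_add_distrib, add_eq_left]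
    refine Finset.sum_eq_zero fun k' _ => ?_
    by_cases h : k' = k
    · subst h
      have : ρ k' j' ≠ j := fun h => hj ((hk' j').1 h).symm
      simp [this]
    · by_cases h' : ρ k' j' = j
      · rw [h']; simp [h]
      · simp [h']

lemma lookup_eq_some_of_forall {α β : Type*} [BEq α] [LawfulBEq α] {L : List (α × β)} {s : α} {v : β}
    (h : (s, v) ∈ L) (huniq : ∀ v', (s, v') ∈ L → v' = v) : L.lookup s = some v := by
  cases hl : L.lookup s with
  | none => exact absurd rfl ((by simpa using List.lookup_eq_none_iff.1 hl _ h : s ≠ s))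
  | some v' =>
    rw [huniq v']
    obtain ⟨l₁, l₂, hL, -⟩ := List.lookup_eq_some_iff.1 hl
    rw [hL]; simp

lemma mem_rawList {FF : Type*} {m d δ : ℕ} {q : Fin m → Fin d → ℤ} {r : Fin m → Fin d → FF}
    {k : Fin d} {x : ℤ} {v : FF} :
    ((k, x), v) ∈ rawList δ q r ↔
      ∃ e ∈ intervals δ (fun i => q i k) (fun i => r i k), x ∈ e.1 ∧ e.2 = v := by
  simp only [rawList, List.mem_flatMap, List.mem_finRange, true_and, List.mem_map,
    Finset.mem_toList, Prod.mk.injEq]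
  constructor
  · rintro ⟨k', e, he, x', hx', ⟨rfl, rfl⟩, rfl⟩
    exact ⟨e, he, hx', rfl⟩
  · rintro ⟨e, he, hx, rfl⟩
    exact ⟨k, e, he, x, hx, ⟨rfl, rfl⟩, rfl⟩

lemma length_rawList_le {FF : Type*} {m d δ : ℕ} (q : Fin m → Fin d → ℤ)
    (r : Fin m → Fin d → FF) : (rawList δ q r).length ≤ m * d * (2 * δ + 1) := by
  simp only [rawList, List.length_flatMap, List.length_map, Finset.length_toList]
  refine (List.sum_le_card_nsmul _ (m * (2 * δ + 1)) ?_).trans ?_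
  · intro y hy
    obtain ⟨k, -, rfl⟩ := List.mem_map.1 hy
    exact sum_card_intervals_le _ _
  · simp only [List.length_map, List.length_finRange, smul_eq_mul]
    exact le_of_eq (by ring)

lemma length_paddedList_le {FF : Type*} {m d a δ : ℕ} (keyEnc : (Fin d × ℤ) ⊕ ℕ → BitStr a)
    (q : Fin m → Fin d → ℤ) (r : Fin m → Fin d → FF) (dummy : Fin (m * d * (2 * δ + 1)) → FF) :
    (paddedList δ keyEnc q r dummy).length ≤ m * d * (2 * δ + 1) := by
  have := length_rawList_le (δ := δ) q r
  simp only [paddedList, List.length_append, List.length_map, List.length_take]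
  omega

/-- Within distance `δ` of the `j`-th element, the list holds the value of that element. -/
lemma lookup_paddedList {FF : Type*} [Zero FF] {m d u a δ : ℕ}
    {keyEnc : (Fin d × ℤ) ⊕ ℕ → BitStr a}
    (hkey : Set.InjOn keyEnc (Sum.inl '' {p : Fin d × ℤ | -(δ : ℤ) ≤ p.2 ∧ p.2 < 2 ^ u + δ}))
    (Q : Input m d u) (r : Fin m → Fin d → FF) (dummy : Fin (m * d * (2 * δ + 1)) → FF)
    (j : Fin m) (k : Fin d) {y : ℤ}
    (hy : y ∈ Finset.Icc (Q.toInt j k - δ) (Q.toInt j k + δ)) :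
    (paddedList δ keyEnc Q.toInt r dummy).lookup (keyEnc (Sum.inl (k, y))) =
      some (valueAt (intervals δ (fun i => Q.toInt i k) (fun i => r i k)) (Q.toInt j k)) := by
  have hrange : ∀ k, ∀ e ∈ intervals δ (fun i => Q.toInt i k) (fun i => r i k), ∀ x ∈ e.1,
      -(δ : ℤ) ≤ x ∧ x < 2 ^ u + δ := by
    intro k
    refine forall_mem_intervals _ _ (fun x => -(δ : ℤ) ≤ x ∧ x < 2 ^ u + δ) fun i x hx => ?_
    have h1 : (0 : ℤ) ≤ Q.toInt i k := Int.natCast_nonneg _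
    have h2 : Q.toInt i k < 2 ^ u := by
      have := (Q i k).isLt
      simp only [Input.toInt]
      exact_mod_cast this
    rw [Finset.mem_Icc] at hx
    omega
  obtain ⟨e, he, hsub⟩ := exists_mem_intervals_of_index (δ := δ) (fun i => Q.toInt i k)
    (fun i => r i k) j
  rw [valueAt_of_mem he (hsub (mem_Icc_self_sub_add _))]
  rw [paddedList, List.lookup_append, lookup_eq_some_of_forall (v := e.2)]
  · rfl
  · exact List.mem_map.2 ⟨((k, y), e.2), mem_rawList.2 ⟨e, he, hsub hy, rfl⟩, rfl⟩
  · intro v' hv'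
    obtain ⟨⟨⟨k', y'⟩, w⟩, hmem, heq⟩ := List.mem_map.1 hv'
    simp only [Prod.mk.injEq] at heq
    obtain ⟨heq, rfl⟩ := heq
    obtain ⟨e', he', hy', rfl⟩ := mem_rawList.1 hmem
    have := hkey ⟨(k', y'), hrange k' e' he' y' hy', rfl⟩ ⟨(k, y), hrange k e he y (hsub hy), rfl⟩
      heq
    simp only [Sum.inl.injEq, Prod.mk.injEq] at this
    obtain ⟨rfl, rfl⟩ := this
    rw [eq_of_mem_intervals he he' (hsub hy) hy']

/-! ### Exchanging the two parties -/

section Swap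

variable {FF KK : Type}

/-- The parameters with the roles of the two parties exchanged. -/
def Params.swap (P : Params FF KK) : Params FF KK where
  m := P.n
  n := P.m
  d := P.d
  δ := P.δ
  u := P.u
  a := P.a
  keyEnc := P.keyEnc
  keyEnc_injOn := by rw [max_comm]; exact P.keyEnc_injOn
  ℓ := P.ℓ
  encF := P.encF
  encF_injective := P.encF_injective
  c := P.c
  encK := P.encK
  encK_injective := P.encK_injective
  F := P.F

/-- The coins with the roles of the two parties exchanged. -/
def coinsSwap (P : Params FF KK) : Coins P ≃ Coins P.swap where
  toFun ω := ⟨ω.receiver, ω.sender, ω.opprf₂, ω.opprf₁⟩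
  invFun ω := ⟨ω.receiver, ω.sender, ω.opprf₂, ω.opprf₁⟩
  left_inv _ := rfl
  right_inv _ := rfl

lemma prob_comp_equiv {Ω Ω' : Type*} [Finite Ω] [Finite Ω'] (e : Ω ≃ Ω') (E : Ω' → Prop) :
    prob (fun ω => E (e ω)) = prob E := by
  rw [prob_eq_avg, prob_eq_avg, avg_congr_equiv e fun ω => ind (E ω)]

variable [AddCommGroup FF] [AddCommGroup KK] (P : Params FF KK)
  (Q : Input P.m P.d P.u) (W : Input P.n P.d P.u) (ω : Coins P)

lemma idW_eq_swap : P.idW Q W ω = P.swap.idQ W Q (coinsSwap P ω) := rfl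

end Swap

lemma bitOracle_enc {FF : Type*} {ℓ : ℕ} {enc : FF → BitStr ℓ} (h : Function.Injective enc)
    (f : FF → FF) (x : FF) : bitOracle enc f (enc x) = enc (f x) :=
  h.extend_apply _ _ _

/-! ### Identifiers in terms of the pseudorandom function -/

set_option linter.unusedSectionVars false

section Core

variable {FF KK : Type} [AddCommGroup FF] [AddCommGroup KK] (P : Params FF KK)
  (Q : Input P.m P.d P.u) (W : Input P.n P.d P.u)

/-- Coins that determine the second OPPRF function: the receiver's sampled and dummy values and the
random function. -/
abbrev OtherCoins : Type :=
  (Fin P.n → Fin P.d → FF) × (Fin (P.n * P.d * (2 * P.δ + 1)) → FF) × (BitStr P.a → FF)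

/-- The values of the second OPPRF function at the sender's queries. -/
noncomputable def opprfValue (z : OtherCoins P) (p : Fin P.m × Fin P.d) : FF :=
  programmed (paddedList P.δ P.keyEnc W.toInt z.1 z.2.1) z.2.2
    (P.keyEnc (Sum.inl (p.2, Q.toInt p.1 p.2)))

/-- The point at which the keyed function is evaluated to get `ID_{q_j}`. -/
noncomputable def idPoint (r : Fin P.m → Fin P.d → FF) (z : OtherCoins P) (j : Fin P.m) : FF :=
  ∑ k, opprfValue P Q W z (j, k) + pid P.δ Q.toInt r j

lemma idQ_eq (ω : Coins P) (j : Fin P.m) :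
    P.idQ Q W ω j = P.F (ω.receiver.key + ω.sender.key)
      (idPoint P Q W ω.sender.r (ω.receiver.r, ω.receiver.dummy, ω.opprf₂.fn) j) := by
  simp only [Params.idQ, siOPRF, Params.out₂, soOPPRF, idPoint, opprfValue,
    Finset.sum_sub_distrib]
  congr 1
  abel

lemma opprfValue_eq_of_close {i : Fin P.n} {j : Fin P.m}
    (h : dist (W.toInt i) (Q.toInt j) ≤ P.δ) (z : OtherCoins P) (k : Fin P.d) :
    opprfValue P Q W z (j, k) =
      valueAt (intervals P.δ (fun i => W.toInt i k) fun i => z.1 i k) (W.toInt i k) := by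
  have h1 := (dist_pi_le_iff (Nat.cast_nonneg P.δ)).1 h k
  rw [Int.dist_eq, ← Int.cast_sub, ← Int.cast_abs] at h1
  have h2 : |W.toInt i k - Q.toInt j k| ≤ (P.δ : ℤ) := by exact_mod_cast h1
  rw [abs_le] at h2
  rw [opprfValue, programmed, lookup_paddedList (u := P.u)
    (P.keyEnc_injOn.mono Set.subset_union_left) W z.1 z.2.1 i k (y := Q.toInt j k)
    (by rw [Finset.mem_Icc]; omega)]
  rfl

lemma sum_opprfValue_of_close {i : Fin P.n} {j : Fin P.m}
    (h : dist (W.toInt i) (Q.toInt j) ≤ P.δ) (z : OtherCoins P) :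
    ∑ k, opprfValue P Q W z (j, k) = pid P.δ W.toInt z.1 i :=
  Finset.sum_congr rfl fun k _ => opprfValue_eq_of_close P Q W h z k

lemma idQ_eq_idW_of_close {i : Fin P.n} {j : Fin P.m} (h : dist (W.toInt i) (Q.toInt j) ≤ P.δ)
    (ω : Coins P) : P.idQ Q W ω j = P.idW Q W ω i := by
  rw [idW_eq_swap, idQ_eq]
  refine Eq.trans ?_ (idQ_eq P.swap W Q (coinsSwap P ω) i).symm
  have h1 := sum_opprfValue_of_close P Q W h (ω.receiver.r, ω.receiver.dummy, ω.opprf₂.fn)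
  have h2 := sum_opprfValue_of_close P.swap W Q (i := j) (j := i) (by rw [dist_comm]; exact h)
    (ω.sender.r, ω.sender.dummy, ω.opprf₁.fn)
  have h3 : idPoint P Q W ω.sender.r (ω.receiver.r, ω.receiver.dummy, ω.opprf₂.fn) j =
      idPoint P.swap W Q ω.receiver.r (ω.sender.r, ω.sender.dummy, ω.opprf₁.fn) i := by
    exact (congrArg (· + pid P.δ Q.toInt ω.sender.r j) h1).trans ((add_comm _ _).trans
      (congrArg (· + pid P.δ W.toInt ω.receiver.r i) h2).symm)
  rw [h3, add_comm ω.receiver.key]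
  rfl

/-! ### Reparametrization of the coins -/

/-- The sender's coins other than the sampled values, its shares in the first OPPRF invocation, and
the shares it receives in the second one. -/
abbrev OwnCoins : Type :=
  (Fin (P.m * P.d * (2 * P.δ + 1)) → FF) × KK × (Fin P.n × Fin P.d → FF) × (Fin P.m × Fin P.d → FF)

/-- All coins up to the PRF key and the first OPPRF function. -/
abbrev FixedCoins : Type := (Fin P.m → Fin P.d → FF) × OwnCoins P × OtherCoins P

/-- The coins in terms of the total PRF key and of the shares that the sender receives. -/
noncomputable def coinsEquiv : Coins P ≃ (FixedCoins P × KK) × (BitStr P.a → FF) where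
  toFun ω := (((ω.sender.r,
    (ω.sender.dummy, ω.sender.key, ω.opprf₁.share,
      opprfValue P Q W (ω.receiver.r, ω.receiver.dummy, ω.opprf₂.fn) - ω.opprf₂.share),
    (ω.receiver.r, ω.receiver.dummy, ω.opprf₂.fn)),
    ω.receiver.key + ω.sender.key), ω.opprf₁.fn)
  invFun x :=
    { sender := ⟨x.1.1.1, x.1.1.2.1.1, x.1.1.2.1.2.1⟩
      receiver := ⟨x.1.1.2.2.1, x.1.1.2.2.2.1, x.1.2 - x.1.1.2.1.2.1⟩
      opprf₁ := ⟨x.2, x.1.1.2.1.2.2.1⟩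
      opprf₂ := ⟨x.1.1.2.2.2.2, opprfValue P Q W x.1.1.2.2 - x.1.1.2.1.2.2.2⟩ }
  left_inv ω := by simp
  right_inv x := by simp

/-- The sender's view with given identifiers. -/
noncomputable def simView (r : Fin P.m → Fin P.d → FF) (y : OwnCoins P) (ids : Fin P.m → FF)
    (g : BitStr P.a → FF) : View FF KK P.m P.n P.d P.δ P.u P.a where
  input := Q
  coins := ⟨r, y.1, y.2.1⟩
  asSender := y.2.2.1
  oracle := programmed (paddedList P.δ P.keyEnc Q.toInt r y.1) g
  asReceiver := y.2.2.2
  ids := ids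

lemma viewS_eq (ω : Coins P) :
    P.viewS Q W ω =
      (fun x : (FixedCoins P × KK) × (BitStr P.a → FF) => simView P Q x.1.1.1 x.1.1.2.1
        (P.F x.1.2 ∘ idPoint P Q W x.1.1.1 x.1.1.2.2) x.2) (coinsEquiv P Q W ω) := by
  have : P.idQ Q W ω = _ := funext (idQ_eq P Q W ω)
  simp only [Params.viewS, this]
  rfl

variable [Finite FF] [Finite KK]

/-- The acceptance probability on the sender's view with given identifiers. -/
noncomputable def acceptProb (D : Circuit (ViewBit P.m P.n P.d P.δ P.u P.ℓ P.c) P.a P.ℓ)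
    (r : Fin P.m → Fin P.d → FF) (y : OwnCoins P) (ids : Fin P.m → FF) : ℝ :=
  avg fun g => ind ((simView P Q r y ids g).acceptedBy P.encF P.encK D)

lemma prob_viewS (D : Circuit (ViewBit P.m P.n P.d P.δ P.u P.ℓ P.c) P.a P.ℓ) :
    prob (fun ω : Coins P => (P.viewS Q W ω).acceptedBy P.encF P.encK D) =
      avg fun x : FixedCoins P => avg fun K =>
        acceptProb P Q D x.1 x.2.1 (P.F K ∘ idPoint P Q W x.1 x.2.2) := by
  simp only [viewS_eq]
  refine (prob_comp_equiv (coinsEquiv P Q W) fun x => (simView P Q x.1.1.1 x.1.1.2.1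
    (P.F x.1.2 ∘ idPoint P Q W x.1.1.1 x.1.1.2.2) x.2).acceptedBy P.encF P.encK D).trans ?_
  rw [prob_eq_avg, avg_prod, avg_prod]
  rfl

lemma prob_idQ_eq (j j' : Fin P.m) :
    prob (fun ω : Coins P => P.idQ Q W ω j = P.idQ Q W ω j') =
      avg fun x : FixedCoins P => avg fun K =>
        ind (P.F K (idPoint P Q W x.1 x.2.2 j) = P.F K (idPoint P Q W x.1 x.2.2 j')) := by
  simp only [idQ_eq]
  have := prob_comp_equiv (coinsEquiv P Q W) fun x => P.F x.1.2 (idPoint P Q W x.1.1.1 x.1.1.2.2 j) =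
    P.F x.1.2 (idPoint P Q W x.1.1.1 x.1.1.2.2 j')
  refine this.trans ?_
  rw [prob_eq_avg, avg_prod]
  simp only [avg_const]
  rw [avg_prod]

/-! ### Replacing the pseudorandom function by a random one -/

/-- Circuits of size at most `S` have advantage at most `ε` against the pseudorandom function. -/
def PRFBound (S : ℕ) (ε : ℝ) : Prop :=
  ∀ C : Circuit Empty P.ℓ P.ℓ, C.size ≤ S →
    |prob (fun k : KK => C.accepts (bitOracle P.encF (P.F k)) Empty.elim) -
      prob (fun f : FF → FF => C.accepts (bitOracle P.encF f) Empty.elim)| ≤ ε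

/-- The expected value of `φ` changes by at most `ε` if the keyed function is replaced by a
random one. -/
def Fooled (ε : ℝ) (φ : (BitStr P.ℓ → BitStr P.ℓ) → ℝ) : Prop :=
  |(avg fun k : KK => φ (bitOracle P.encF (P.F k))) -
    avg fun f : FF → FF => φ (bitOracle P.encF f)| ≤ ε

variable {P Q W}

lemma Fooled.of_circuit {S : ℕ} {ε : ℝ} (h : PRFBound P S ε) {C : Circuit Empty P.ℓ P.ℓ}
    (hC : C.size ≤ S) : Fooled P ε fun O => ind (C.accepts O Empty.elim) := by
  have := h C hC
  rwa [prob_eq_avg, prob_eq_avg] at this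

lemma Fooled.average {ε : ℝ} {V : Type*} [Finite V] [Nonempty V]
    {φ : V → (BitStr P.ℓ → BitStr P.ℓ) → ℝ} (h : ∀ v, Fooled P ε (φ v)) :
    Fooled P ε fun O => avg fun v => φ v O := by
  unfold Fooled
  rw [avg_comm, avg_comm (fun (f : FF → FF) v => φ v (bitOracle P.encF f))]
  exact (abs_avg_sub_avg_le h).trans_eq (avg_const ε)

/-- The size of a PRF distinguisher that runs a circuit of size `s` on a simulated view. -/
def simSize (m d δ a ℓ s : ℕ) : ℕ :=
  2 + m * (1 + ℓ + ℓ) + s * (1 + (m * d * (2 * δ + 1) + s) * (1 + a * 7 + ℓ * 4)) + 2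

lemma avail_queries {ℓ n : ℕ} (s : Fin n → BitStr ℓ) :
    Avail (2 + n * (1 + ℓ + ℓ))
      ({f : OracleFn ℓ ℓ | (∃ v : Bool, f = fun _ => v) ∨ ∃ j t, f = fun O => O (s j) t}) := by
  have key : ∀ l : List (Fin n), Avail (2 + l.length * (1 + ℓ + ℓ))
      ({f : OracleFn ℓ ℓ | (∃ v : Bool, f = fun _ => v) ∨
        ∃ j ∈ l, ∃ t, f = fun O => O (s j) t}) := by
    intro l
    induction l with
    | nil =>
      refine ((Avail.empty.const true).const false).mono ?_ (by simp)
      rintro f (⟨v, rfl⟩ | ⟨j, hj, -⟩)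
      · cases v <;> simp
      · simp at hj
    | cons j l ih =>
      refine (ih.query (fun i _ => s j i) fun i => Or.inl ⟨_, rfl⟩).mono ?_
        (by rw [List.length_cons, Nat.add_mul]; omega)
      rintro f (⟨v, rfl⟩ | ⟨j', hj', t, rfl⟩)
      · exact Or.inl (Or.inl ⟨v, rfl⟩)
      · rcases List.mem_cons.1 hj' with rfl | hj'
        · exact Or.inr ⟨t, rfl⟩
        · exact Or.inl (Or.inr ⟨j', hj', t, rfl⟩)
  refine (key (List.finRange n)).mono ?_ (by simp)
  rintro f (h | ⟨j, t, rfl⟩)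
  · exact Or.inl h
  · exact Or.inr ⟨j, List.mem_finRange j, t, rfl⟩

lemma abs_avg_acceptProb_sub_le {S : ℕ} {ε : ℝ}
    (D : Circuit (ViewBit P.m P.n P.d P.δ P.u P.ℓ P.c) P.a P.ℓ)
    (hS : simSize P.m P.d P.δ P.a P.ℓ D.size ≤ S) (h : PRFBound P S ε)
    (r : Fin P.m → Fin P.d → FF) (y : OwnCoins P) (x : Fin P.m → FF) :
    |(avg fun K => acceptProb P Q D r y (P.F K ∘ x)) -
      avg fun f : FF → FF => acceptProb P Q D r y (f ∘ x)| ≤ ε := by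
  let L := paddedList P.δ P.keyEnc Q.toInt r y.1
  let T : List ((Fin P.a → OracleFn P.ℓ P.ℓ) × FF) := L.map fun e => (fun i _ => e.1 i, e.2)
  have hT : ∀ O, evalTable T O = L := fun O => List.map_map.trans (List.map_id _)
  let input : ViewBit P.m P.n P.d P.δ P.u P.ℓ P.c → OracleFn P.ℓ P.ℓ := fun i O =>
    match i with
    | .id j t => O (P.encF (x j)) t
    | i => (simView P Q r y 0 0).bits P.encF P.encK i
  have hbits : ∀ (f : FF → FF) g, (simView P Q r y (f ∘ x) g).bits P.encF P.encK =
      fun i => input i (bitOracle P.encF f) := by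
    intro f g; funext i
    cases i <;> first
      | rfl
      | simp only [input, bitOracle_enc P.encF_injective]; rfl
  have hlen : T.length ≤ P.m * P.d * (2 * P.δ + 1) := by
    simpa [T] using length_paddedList_le P.keyEnc Q.toInt r y.1
  have hD := D.length_le_size
  have key := lazy_sampling (Fooled P ε) (fun φ => Fooled.average)
    (fun C hC => Fooled.of_circuit h hC) P.encF input D T (fun _ _ => false) _ _
    (avail_queries fun j => P.encF (x j)) (fun v => Or.inl ⟨v, rfl⟩)
    (fun i => by
      cases i <;> first
        | exact Or.inl ⟨_, rfl⟩
        | exact Or.inr ⟨_, _, rfl⟩)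
    (fun s => Or.inl ⟨_, rfl⟩)
    (fun e he i => by
      obtain ⟨e', -, rfl⟩ := List.mem_map.1 he
      exact Or.inl ⟨_, rfl⟩)
    (M := P.m * P.d * (2 * P.δ + 1) + D.size) (by omega)
    (le_trans (by unfold simSize; gcongr) hS)
  have hacc : ∀ f : FF → FF, acceptProb P Q D r y (f ∘ x) = avg fun g =>
      ind (D.run (fun s => P.encF (programmed L g s)) (fun i => input i (bitOracle P.encF f))
        (fun _ => false) 0 = true) := by
    intro f
    simp only [acceptProb, View.acceptedBy, hbits]
    rfl
  simp only [hacc]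
  simpa only [Fooled, hT] using key

lemma abs_avg_ind_eq_sub_le {S : ℕ} {ε : ℝ} (hS : 2 + 2 * (1 + P.ℓ + P.ℓ) + (1 + P.ℓ * 7) + 2 ≤ S)
    (h : PRFBound P S ε) (x x' : FF) :
    |(avg fun K => ind (P.F K x = P.F K x')) - avg fun f : FF → FF => ind (f x = f x')| ≤ ε := by
  have h1 := avail_queries (n := 2) ![P.encF x, P.encF x']
  have h2 := h1.beqVec (x := fun t O => O (P.encF x) t) (y := fun t O => O (P.encF x') t)
    (fun t => Or.inr ⟨0, t, rfl⟩) (fun t => Or.inr ⟨1, t, rfl⟩)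
  obtain ⟨C, hC, hacc⟩ := h2.exists_circuit (Set.mem_insert _ _)
  have := Fooled.of_circuit h (hC.trans (by omega))
  simp only [Fooled, hacc, beq_iff_eq] at this
  simpa only [bitOracle_enc P.encF_injective, P.encF_injective.eq_iff] using this

/-! ### Collisions -/

lemma avg_ind_idPoint_eq (hQ : DisjointProjection P.δ Q) {j j' : Fin P.m} (hj : j ≠ j') :
    (avg fun x : FixedCoins P => ind (idPoint P Q W x.1 x.2.2 j = idPoint P Q W x.1 x.2.2 j')) =
      1 / (Nat.card FF : ℝ) := by
  obtain ⟨e, he⟩ := exists_pid_shift (FF := FF) hQ hj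
  have := avg_ind_eq_of_shift
    (fun x : FixedCoins P => idPoint P Q W x.1 x.2.2 j - idPoint P Q W x.1 x.2.2 j')
    (fun z => Equiv.prodCongr (e z) (Equiv.refl _)) (fun z x => by
      simp only [idPoint, Equiv.prodCongr_apply, Prod.map_fst, Prod.map_snd, Equiv.refl_apply,
        (he z x.1).1, (he z x.1).2]
      abel) 0
  simpa only [sub_eq_zero] using this

lemma avg_ind_not_injective_le (hQ : DisjointProjection P.δ Q) :
    (avg fun x : FixedCoins P => ind (¬ Function.Injective (idPoint P Q W x.1 x.2.2))) ≤
      (P.m : ℝ) ^ 2 / (Nat.card FF : ℝ) := by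
  classical
  have hpt : ∀ x : FixedCoins P, ind (¬ Function.Injective (idPoint P Q W x.1 x.2.2)) ≤
      ∑ p ∈ Finset.univ.filter (fun p : Fin P.m × Fin P.m => p.1 ≠ p.2),
        ind (idPoint P Q W x.1 x.2.2 p.1 = idPoint P Q W x.1 x.2.2 p.2) := by
    intro x
    by_cases h : Function.Injective (idPoint P Q W x.1 x.2.2)
    · simp only [h, not_true_eq_false]
      refine le_trans (by simp [ind]) (Finset.sum_nonneg fun p _ => ind_nonneg _)
    · obtain ⟨j, j', heq, hne⟩ := Function.not_injective_iff.1 h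
      refine le_trans (ind_mono fun _ => heq) (Finset.single_le_sum
        (f := fun p : Fin P.m × Fin P.m =>
          ind (idPoint P Q W x.1 x.2.2 p.1 = idPoint P Q W x.1 x.2.2 p.2))
        (fun p _ => ind_nonneg _) (a := (j, j')) (by simpa using hne))
  refine (avg_mono hpt).trans ?_
  rw [avg_sum, Finset.sum_congr rfl fun p hp => avg_ind_idPoint_eq hQ (Finset.mem_filter.1 hp).2,
    Finset.sum_const, nsmul_eq_mul, mul_one_div]
  gcongr
  have := Finset.card_filter_le (Finset.univ : Finset (Fin P.m × Fin P.m)) fun p => p.1 ≠ p.2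
  rw [Finset.card_univ, Fintype.card_prod, Fintype.card_fin, ← sq] at this
  exact_mod_cast this

lemma acceptProb_mem (D : Circuit (ViewBit P.m P.n P.d P.δ P.u P.ℓ P.c) P.a P.ℓ)
    (r : Fin P.m → Fin P.d → FF) (y : OwnCoins P) (ids : Fin P.m → FF) :
    0 ≤ acceptProb P Q D r y ids ∧ acceptProb P Q D r y ids ≤ 1 :=
  avg_mem_unit (fun _ => ind_nonneg _) fun _ => ind_le_one _

/-- The sender's view is close to one with uniformly random identifiers. -/
lemma abs_prob_viewS_sub_le {S : ℕ} {ε : ℝ} (hQ : DisjointProjection P.δ Q)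
    (D : Circuit (ViewBit P.m P.n P.d P.δ P.u P.ℓ P.c) P.a P.ℓ)
    (hS : simSize P.m P.d P.δ P.a P.ℓ D.size ≤ S) (h : PRFBound P S ε) :
    |prob (fun ω : Coins P => (P.viewS Q W ω).acceptedBy P.encF P.encK D) -
      avg fun x : FixedCoins P => avg fun ids => acceptProb P Q D x.1 x.2.1 ids| ≤
      ε + (P.m : ℝ) ^ 2 / (Nat.card FF : ℝ) := by
  rw [prob_viewS]
  have hA := abs_avg_sub_avg_le fun x : FixedCoins P =>
    abs_avg_acceptProb_sub_le (Q := Q) D hS h x.1 x.2.1 (idPoint P Q W x.1 x.2.2)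
  rw [avg_const] at hA
  have hB := (abs_avg_sub_avg_le (f := fun x : FixedCoins P => avg fun f : FF → FF =>
      acceptProb P Q D x.1 x.2.1 (f ∘ idPoint P Q W x.1 x.2.2))
    (g := fun x => avg fun ids => acceptProb P Q D x.1 x.2.1 ids)
    (h := fun x => ind (¬ Function.Injective (idPoint P Q W x.1 x.2.2))) fun x => by
      by_cases hx : Function.Injective (idPoint P Q W x.1 x.2.2)
      · rw [avg_comp_injective _ hx, sub_self, abs_zero]
        exact ind_nonneg _
      · rw [show ind (¬ Function.Injective (idPoint P Q W x.1 x.2.2)) = 1 by simp [ind, hx]]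
        exact abs_sub_le_one
          (avg_mem_unit (fun _ => (acceptProb_mem D _ _ _).1) fun _ => (acceptProb_mem D _ _ _).2)
          (avg_mem_unit (fun _ => (acceptProb_mem D _ _ _).1)
            fun _ => (acceptProb_mem D _ _ _).2)).trans (avg_ind_not_injective_le hQ)
  exact (abs_sub_le _ _ _).trans (add_le_add hA hB)

/-- The sender's views for two inputs of the receiver are close. -/
lemma abs_prob_viewS_sub_prob_viewS_le {S : ℕ} {ε : ℝ} (hQ : DisjointProjection P.δ Q)
    (W' : Input P.n P.d P.u) (D : Circuit (ViewBit P.m P.n P.d P.δ P.u P.ℓ P.c) P.a P.ℓ)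
    (hS : simSize P.m P.d P.δ P.a P.ℓ D.size ≤ S) (h : PRFBound P S ε) :
    |prob (fun ω : Coins P => (P.viewS Q W ω).acceptedBy P.encF P.encK D) -
      prob (fun ω : Coins P => (P.viewS Q W' ω).acceptedBy P.encF P.encK D)| ≤
      2 * (ε + (P.m : ℝ) ^ 2 / (Nat.card FF : ℝ)) := by
  have h1 := abs_prob_viewS_sub_le (W := W) hQ D hS h
  have h2 := abs_prob_viewS_sub_le (W := W') hQ D hS h
  rw [abs_sub_comm] at h2
  linarith [abs_sub_le (prob (fun ω : Coins P => (P.viewS Q W ω).acceptedBy P.encF P.encK D))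
    (avg fun x : FixedCoins P => avg fun ids => acceptProb P Q D x.1 x.2.1 ids)
    (prob (fun ω : Coins P => (P.viewS Q W' ω).acceptedBy P.encF P.encK D))]

/-- Identifiers of different elements rarely collide. -/
lemma prob_idQ_eq_le {S : ℕ} {ε : ℝ} (hQ : DisjointProjection P.δ Q) {j j' : Fin P.m} (hj : j ≠ j')
    (hS : 2 + 2 * (1 + P.ℓ + P.ℓ) + (1 + P.ℓ * 7) + 2 ≤ S) (h : PRFBound P S ε) :
    prob (fun ω : Coins P => P.idQ Q W ω j = P.idQ Q W ω j') ≤ ε + 2 / (Nat.card FF : ℝ) := by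
  rw [prob_idQ_eq]
  have hpt : ∀ x : FixedCoins P, (avg fun K =>
      ind (P.F K (idPoint P Q W x.1 x.2.2 j) = P.F K (idPoint P Q W x.1 x.2.2 j'))) ≤
      (ε + 1 / (Nat.card FF : ℝ)) +
        ind (idPoint P Q W x.1 x.2.2 j = idPoint P Q W x.1 x.2.2 j') := by
    intro x
    have h1 := abs_avg_ind_eq_sub_le hS h (idPoint P Q W x.1 x.2.2 j) (idPoint P Q W x.1 x.2.2 j')
    have h2 := avg_ind_apply_eq_le (G := FF) (idPoint P Q W x.1 x.2.2 j)
      (idPoint P Q W x.1 x.2.2 j')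
    linarith [(abs_le.1 h1).2]
  refine (avg_mono hpt).trans_eq ?_
  rw [avg_add, avg_const, avg_ind_idPoint_eq hQ hj]
  ring

lemma prob_idW_eq_le {S : ℕ} {ε : ℝ} (hW : DisjointProjection P.δ W) {i i' : Fin P.n} (hi : i ≠ i')
    (hS : 2 + 2 * (1 + P.ℓ + P.ℓ) + (1 + P.ℓ * 7) + 2 ≤ S) (h : PRFBound P S ε) :
    prob (fun ω : Coins P => P.idW Q W ω i = P.idW Q W ω i') ≤ ε + 2 / (Nat.card FF : ℝ) :=
  (prob_comp_equiv (coinsSwap P)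
      fun ω : Coins P.swap => P.swap.idQ W Q ω i = P.swap.idQ W Q ω i').trans_le
    (prob_idQ_eq_le (P := P.swap) (Q := W) (W := Q) hW hi hS h)

end Core

/-! ### Polynomially bounded and negligible functions -/

lemma monotone_eval_nat (p : Polynomial ℕ) : Monotone fun x : ℕ => p.eval x := by
  intro x y h
  simp only [Polynomial.eval_eq_sum, Polynomial.sum]
  gcongr

lemma PolyBounded.const (c : ℕ) : PolyBounded fun _ => c :=
  ⟨Polynomial.C c, fun κ => by simp⟩

lemma PolyBounded.add {f g : ℕ → ℕ} (hf : PolyBounded f) (hg : PolyBounded g) :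
    PolyBounded fun κ => f κ + g κ := by
  obtain ⟨p, hp⟩ := hf
  obtain ⟨q, hq⟩ := hg
  exact ⟨p + q, fun κ => by rw [Polynomial.eval_add]; exact add_le_add (hp κ) (hq κ)⟩

lemma PolyBounded.mul {f g : ℕ → ℕ} (hf : PolyBounded f) (hg : PolyBounded g) :
    PolyBounded fun κ => f κ * g κ := by
  obtain ⟨p, hp⟩ := hf
  obtain ⟨q, hq⟩ := hg
  exact ⟨p * q, fun κ => by rw [Polynomial.eval_mul]; exact Nat.mul_le_mul (hp κ) (hq κ)⟩

lemma polyBounded_simSize {m d δ a ℓ s : ℕ → ℕ} (hm : PolyBounded m) (hd : PolyBounded d)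
    (hδ : PolyBounded δ) (ha : PolyBounded a) (hℓ : PolyBounded ℓ) (hs : PolyBounded s) :
    PolyBounded fun κ => simSize (m κ) (d κ) (δ κ) (a κ) (ℓ κ) (s κ) := by
  have c := PolyBounded.const
  exact ((((c 2).add (hm.mul (((c 1).add hℓ).add hℓ))).add
    (hs.mul ((c 1).add (((((hm.mul hd).mul (((c 2).mul hδ).add (c 1))).add hs)).mul
      (((c 1).add (ha.mul (c 7))).add (hℓ.mul (c 4))))))).add (c 2))

open Filter Asymptotics Topology

lemma negligible_one_div_two_pow : Negligible fun l => 1 / (2 : ℝ) ^ l := by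
  intro n
  simpa [div_eq_mul_inv] using tendsto_pow_const_div_const_pow_of_one_lt n (one_lt_two (α := ℝ))

lemma PolyRelated.tendsto {lam : ℕ → ℕ} (h : PolyRelated lam) : Tendsto lam atTop atTop := by
  obtain ⟨-, p, hp⟩ := h
  refine tendsto_atTop.2 fun b => ?_
  filter_upwards [eventually_gt_atTop (p.eval b)] with κ hκ
  by_contra! hlt
  exact absurd ((hp κ).trans (monotone_eval_nat p hlt.le)) (not_le.2 hκ)

lemma negligible_poly_div_two_pow {lam f : ℕ → ℕ} (h : PolyRelated lam) (hf : PolyBounded f) :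
    Negligible fun κ => (f κ : ℝ) / 2 ^ lam κ := by
  intro n
  obtain ⟨q, hq⟩ := hf
  obtain ⟨p, hp⟩ := h.2
  let R : Polynomial ℕ := p ^ n * q.comp p
  have hR := (negligible_one_div_two_pow.polynomial_mul (R.map (Nat.castRingHom ℝ))) 0
  have hR' := hR.comp h.tendsto
  refine squeeze_zero (fun κ => by positivity) (fun κ => ?_) hR'
  have h1 : (κ : ℝ) ^ n * (f κ : ℝ) ≤ ((R.eval (lam κ) : ℕ) : ℝ) := by
    have h2 : f κ ≤ q.eval (p.eval (lam κ)) := (hq κ).trans (monotone_eval_nat q (hp κ))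
    have h3 : κ ^ n * f κ ≤ R.eval (lam κ) := by
      simp only [R, Polynomial.eval_mul, Polynomial.eval_pow, Polynomial.eval_comp]
      exact Nat.mul_le_mul (Nat.pow_le_pow_left (hp κ) n) h2
    exact_mod_cast h3
  have h4 : (R.map (Nat.castRingHom ℝ)).eval (lam κ : ℝ) = ((R.eval (lam κ) : ℕ) : ℝ) := by
    simp
  simp only [Function.comp_apply, pow_zero, one_mul, h4, mul_one_div]
  rw [← mul_div_assoc]
  gcongr

/-- A negligible function of `κ` is bounded by a negligible function of `lam κ`. -/
lemma exists_negligible_comp_ge {lam : ℕ → ℕ} (h : PolyRelated lam) {ε : ℕ → ℝ}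
    (hε : Negligible ε) (h0 : ∀ κ, 0 ≤ ε κ) : ∃ ν, Negligible ν ∧ ∀ κ, ε κ ≤ ν (lam κ) := by
  obtain ⟨p, hp⟩ := h.2
  obtain ⟨q, hq⟩ := h.1
  have hfin : ∀ l, {κ | lam κ = l}.Finite := fun l =>
    (Set.finite_Iic (p.eval l)).subset fun κ hκ => by
      have h1 : lam κ = l := hκ
      have h2 := hp κ
      rwa [h1] at h2
  have hν : ∀ l, ∃ y : ℝ, (y = 0 ∨ ∃ κ, lam κ = l ∧ y = ε κ) ∧ ∀ κ, lam κ = l → ε κ ≤ y := by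
    intro l
    by_cases hne : {κ | lam κ = l}.Nonempty
    · obtain ⟨κ, hκ, hmax⟩ := Set.exists_max_image _ ε (hfin l) hne
      exact ⟨ε κ, Or.inr ⟨κ, hκ, rfl⟩, hmax⟩
    · exact ⟨0, Or.inl rfl, fun κ hκ => absurd ⟨κ, hκ⟩ hne⟩
  choose ν hν1 hν2 using hν
  refine ⟨ν, fun n => ?_, fun κ => hν2 _ κ rfl⟩
  have hlim := (hε.polynomial_mul ((q ^ n).map (Nat.castRingHom ℝ))) 0
  simp only [pow_zero, one_mul] at hlim
  rw [Metric.tendsto_atTop] at hlim ⊢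
  intro η hη
  obtain ⟨K, hK⟩ := hlim η hη
  refine ⟨(∑ κ ∈ Finset.range K, lam κ) + 1, fun l hl => ?_⟩
  rcases hν1 l with h | ⟨κ, hκ, h⟩
  · simpa [h] using hη
  · have hge : K ≤ κ := by
      by_contra! hlt
      have := Finset.single_le_sum (f := lam) (fun _ _ => Nat.zero_le _) (Finset.mem_range.2 hlt)
      omega
    have h1 := hK κ hge
    have h4 : ((q ^ n).map (Nat.castRingHom ℝ)).eval (κ : ℝ) = ((q.eval κ : ℕ) : ℝ) ^ n := by
      simp
    rw [h4, Real.dist_0_eq_abs] at h1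
    rw [Real.dist_0_eq_abs, h]
    refine lt_of_le_of_lt ?_ h1
    have h5 : (l : ℝ) ≤ (q.eval κ : ℕ) := by
      rw [← hκ]; exact_mod_cast hq κ
    have h6 := h0 κ
    rw [abs_of_nonneg (by positivity), abs_of_nonneg (by positivity)]
    gcongr

/-! ### The theorem -/

section Main

variable {FF KK : ℕ → Type} [∀ κ, AddCommGroup (FF κ)] [∀ κ, Finite (FF κ)]
  [∀ κ, AddCommGroup (KK κ)] [∀ κ, Finite (KK κ)] {P : ∀ κ, Params (FF κ) (KK κ)} {lam : ℕ → ℕ}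

/-- The advantages of all circuits of polynomially bounded size have a common negligible bound. -/
lemma exists_negligible_prfBound
    (hPRF : IsPRF (fun κ => (P κ).encF) (fun κ => (P κ).F)) {S : ℕ → ℕ} (hS : PolyBounded S) :
    ∃ ε : ℕ → ℝ, Negligible ε ∧ (∀ κ, 0 ≤ ε κ) ∧ ∀ κ, PRFBound (P κ) (S κ) (ε κ) := by
  let adv : ∀ κ, Circuit Empty (P κ).ℓ (P κ).ℓ → ℝ := fun κ C =>
    |prob (fun k : KK κ => C.accepts (bitOracle (P κ).encF ((P κ).F k)) Empty.elim) -
      prob (fun f : FF κ → FF κ => C.accepts (bitOracle (P κ).encF f) Empty.elim)|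
  have hadv : ∀ κ C, adv κ C ≤ 1 := by
    intro κ C
    simp only [adv, prob_eq_avg]
    exact abs_sub_le_one (avg_mem_unit (fun _ => ind_nonneg _) fun _ => ind_le_one _)
      (avg_mem_unit (fun _ => ind_nonneg _) fun _ => ind_le_one _)
  have hex : ∀ κ, ∃ C₀ : Circuit Empty (P κ).ℓ (P κ).ℓ, C₀.size ≤ S κ ∧
      ∀ C : Circuit Empty (P κ).ℓ (P κ).ℓ, C.size ≤ S κ → adv κ C ≤ 2 * adv κ C₀ := by
    intro κ
    set A := adv κ '' {C | C.size ≤ S κ} with hA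
    have hbdd : BddAbove A := ⟨1, by rintro _ ⟨C, -, rfl⟩; exact hadv κ C⟩
    have hne : A.Nonempty := ⟨_, [], by simp [Circuit.size], rfl⟩
    by_cases hs : 0 < sSup A
    · obtain ⟨_, ⟨C₀, hC₀, rfl⟩, hlt⟩ := exists_lt_of_lt_csSup hne (half_lt_self hs)
      refine ⟨C₀, hC₀, fun C hC => ?_⟩
      have := le_csSup hbdd ⟨C, hC, rfl⟩
      linarith
    · refine ⟨[], by simp [Circuit.size], fun C hC => ?_⟩
      have := le_csSup hbdd ⟨C, hC, rfl⟩
      have : 0 ≤ adv κ [] := abs_nonneg _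
      linarith
  choose C₀ hC₀ hmax using hex
  have hsize : PolyBounded fun κ => (C₀ κ).size := by
    obtain ⟨p, hp⟩ := hS
    exact ⟨p, fun κ => (hC₀ κ).trans (hp κ)⟩
  exact ⟨fun κ => 2 * adv κ (C₀ κ), (hPRF C₀ hsize).const_mul 2,
    fun κ => mul_nonneg zero_le_two (abs_nonneg _), hmax⟩

lemma two_pow_le_card {n l N : ℕ} (hn : n ≠ 0) (h : n ^ 2 * 2 ^ l ≤ N) : (2 : ℝ) ^ l ≤ N := by
  have : 2 ^ l ≤ N := (Nat.le_mul_of_pos_left _ (pow_pos (Nat.pos_of_ne_zero hn) 2)).trans h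
  exact_mod_cast this

lemma correctness {FF KK : ℕ → Type} [∀ κ, AddCommGroup (FF κ)] [∀ κ, AddCommGroup (KK κ)]
    (P : ∀ κ, Params (FF κ) (KK κ)) : Correctness P :=
  fun κ Q W _ ω _ _ h => idQ_eq_idW_of_close (P κ) Q W h ω

lemma distinctiveness (hlam : PolyRelated lam) (hℓ : PolyBounded fun κ => (P κ).ℓ)
    (hFF : ∀ κ, (P κ).n ^ 2 * 2 ^ lam κ ≤ Nat.card (FF κ))
    (hPRF : IsPRF (fun κ => (P κ).encF) (fun κ => (P κ).F)) : Distinctiveness P lam := by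
  have c := PolyBounded.const
  obtain ⟨ε, hε, h0, hb⟩ := exists_negligible_prfBound hPRF
    ((((c 2).add ((c 2).mul (((c 1).add hℓ).add hℓ))).add ((c 1).add (hℓ.mul (c 7)))).add (c 2))
  obtain ⟨ν, hν, hεν⟩ := exists_negligible_comp_ge hlam hε h0
  refine ⟨fun l => ν l + 2 * (1 / 2 ^ l), hν.add (negligible_one_div_two_pow.const_mul 2), ?_⟩
  intro κ Q W hQW i i' hi
  refine (prob_idW_eq_le hQW.2 hi le_rfl (hb κ)).trans (add_le_add (hεν κ) ?_)
  rw [mul_one_div]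
  have := two_pow_le_card (fun h0 : (P κ).n = 0 => (Fin.cast h0 i).elim0) (hFF κ)
  gcongr

lemma senderSecurity (hlam : PolyRelated lam) (hm : PolyBounded fun κ => (P κ).m)
    (hd : PolyBounded fun κ => (P κ).d) (hδ : PolyBounded fun κ => (P κ).δ)
    (ha : PolyBounded fun κ => (P κ).a) (hℓ : PolyBounded fun κ => (P κ).ℓ)
    (hFF : ∀ κ, (P κ).n = 0 ∨ (P κ).m = 0 ∨ (2 : ℝ) ^ lam κ ≤ Nat.card (FF κ))
    (hPRF : IsPRF (fun κ => (P κ).encF) (fun κ => (P κ).F)) : SenderSecurity P := by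
  intro D hD
  obtain ⟨ε, hε, h0, hb⟩ := exists_negligible_prfBound hPRF (polyBounded_simSize hm hd hδ ha hℓ hD)
  refine ⟨fun κ => 2 * (ε κ + ((P κ).m * (P κ).m : ℕ) / 2 ^ lam κ),
    (hε.add (negligible_poly_div_two_pow hlam (hm.mul hm))).const_mul 2, ?_⟩
  intro κ Q W W' hQW _
  have key := abs_prob_viewS_sub_prob_viewS_le (W := W) hQW.1 W' (D κ) le_rfl (hb κ)
  have hε0 := h0 κ
  rcases hFF κ with hn | hm0 | hcard
  · have : W = W' := funext fun i => (Fin.cast hn i).elim0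
    rw [this, sub_self, abs_zero]
    positivity
  · refine key.trans ?_
    simp [hm0]
  · refine key.trans ?_
    push_cast
    rw [← sq]
    gcongr

lemma receiverSecurity_of_swap (h : SenderSecurity fun κ => (P κ).swap) : ReceiverSecurity P := by
  intro D hD
  obtain ⟨ν, hν, hb⟩ := h D hD
  refine ⟨ν, hν, fun κ Q Q' W h1 h2 => ?_⟩
  have key : ∀ Q, prob (fun ω : Coins (P κ) =>
        ((P κ).viewR Q W ω).acceptedBy (P κ).encF (P κ).encK (D κ)) =
      prob (fun ω : Coins (P κ).swap =>
        ((P κ).swap.viewS W Q ω).acceptedBy (P κ).encF (P κ).encK (D κ)) :=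
    fun Q => prob_comp_equiv (coinsSwap (P κ)) fun ω : Coins (P κ).swap =>
        ((P κ).swap.viewS W Q ω).acceptedBy (P κ).encF (P κ).encK (D κ)
  rw [key, key]
  exact hb κ W Q Q' ⟨h1.2, h1.1⟩ ⟨h2.2, h2.1⟩

end Main

end FuzzyMapping

theorem mainTheorem2
    {FF KK : ℕ → Type}
    [∀ κ, AddCommGroup (FF κ)] [∀ κ, Finite (FF κ)]
    [∀ κ, AddCommGroup (KK κ)] [∀ κ, Finite (KK κ)]
    (P : ∀ κ, FuzzyMapping.Params (FF κ) (KK κ)) (lam : ℕ → ℕ)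
    (hlam : FuzzyMapping.PolyRelated lam)
    (hm : FuzzyMapping.PolyBounded fun κ => (P κ).m)
    (hn : FuzzyMapping.PolyBounded fun κ => (P κ).n)
    (hd : FuzzyMapping.PolyBounded fun κ => (P κ).d)
    (hδ : FuzzyMapping.PolyBounded fun κ => (P κ).δ)
    (ha : FuzzyMapping.PolyBounded fun κ => (P κ).a)
    (hℓ : FuzzyMapping.PolyBounded fun κ => (P κ).ℓ)
    (hFF : ∀ κ, (P κ).n ^ 2 * 2 ^ lam κ ≤ Nat.card (FF κ))
    (hPRF : FuzzyMapping.IsPRF (fun κ => (P κ).encF) (fun κ => (P κ).F)) :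
    FuzzyMapping.Correctness P ∧
      FuzzyMapping.Distinctiveness P lam ∧
      FuzzyMapping.SenderSecurity P ∧
      FuzzyMapping.ReceiverSecurity P := by
  have hcard : ∀ κ, (P κ).n = 0 ∨ (2 : ℝ) ^ lam κ ≤ Nat.card (FF κ) := fun κ =>
    or_iff_not_imp_left.2 fun h => FuzzyMapping.two_pow_le_card h (hFF κ)
  refine ⟨FuzzyMapping.correctness P, FuzzyMapping.distinctiveness hlam hℓ hFF hPRF,
    FuzzyMapping.senderSecurity hlam hm hd hδ ha hℓ (fun κ => (hcard κ).imp_right Or.inr) hPRF,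
    FuzzyMapping.receiverSecurity_of_swap ?_⟩
  exact FuzzyMapping.senderSecurity (P := fun κ => (P κ).swap) hlam hn hd hδ ha hℓ
    (fun κ => Or.inr (hcard κ)) hPRF
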